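/- Throughout, let $n,m\ge 1$ be integers and $p\in[1,\infty)$. The norm $|\cdot|_2$ is the Euclidean norm on vectors and the associated operator norm on matrices in $\mathbb R^{m\times n}$. Let $D\subseteq\mathbb R^n$ be a bounded open set and $\mathcal G$ a subgroup of $\mathrm{SO}(n)$. For $\varepsilon>0$ let $\Gamma_\varepsilon^{\mathcal G}$ be the set of maps $x\mapsto \varepsilon \mathcal R x+h$ with $\mathcal R\in\mathcal G$, $h\in\mathbb R^n$, and let $\Gamma^{\mathcal G}=\bigcup_{\varepsilon>0}\Gamma_\varepsilon^{\mathcal G}$. For open $\Omega\subseteq\mathbb R^n$ let $\mathcal G^D_\varepsilon(\Omega)=\{F(D): F\in\Gamma^{\mathcal G}_\varepsilon,\ F(D)\subseteq\Omega\}$ and $\mathcal G^D(\Omega)=\bigcup_{\varepsilon>0}\mathcal G^D_\varepsilon(\Omega)$. A map $\alpha_p:L^p_{\mathrm{loc}}(\mathbb R^n;\mathbb R^m)\times\mathcal G^D(\mathbb R^n)\to[0,\infty)$ is a *$p$-core functional* if for all $D'\in\mathcal G^D(\mathbb R^n)$ and $u,v\in L^p_{\mathrm{loc}}(\mathbb R^n;\mathbb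 R^m)$: (i) $\alpha_p(u,D')=\alpha_p(v,D')$ whenever $u=v$ a.e. on $D'$; (ii) $\alpha_p(\cdot,D')$ is convex; (iii) $\alpha_p(tu,D')=|t|^p\alpha_p(u,D')$ for $t\in\mathbb R$; (iv) $\alpha_p(u+h,D')=\alpha_p(u,D')$ for $h\in\mathbb R^m$; (v) $\alpha_p(u\circ F,D')=\alpha_p(u,F(D'))$ for $F\in\Gamma^{\mathcal G}$; (vi) there is $c_1>0$ such that $\alpha_p(u,D)\le c_1\int_D|\nabla u|_2^p\,dx$ for all $u\in L^p_{\mathrm{loc}}(\mathbb R^n;\mathbb R^m)$ with $u|_D\in W^{1,p}(D;\mathbb R^m)$. For open $\Omega\subseteq\mathbb R^n$ and $u\in L^p_{\mathrm{loc}}(\mathbb R^n;\mathbb R^m)$ put $$G_\varepsilon(u,\Omega)=\varepsilon^{n-p}\sup_{\mathcal G_\varepsilon}\sum_{D'\in\mathcal G_\varepsilon}\alpha_p(u,D')\in[0,\infty],$$ where $\mathcal G_\varepsilon$ runs over all families of pairwise disjoint elements of $\mathcal G^D_\varepsilon(\Omega)$ (the empty family contributing $0$), and put $G_-(u,\Omega)=\liminf_{\varepsilon\to0^+}G_\varepsilon(u,\Omega)$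 and $G(u,\Omega)=\lim_{\varepsilon\to0^+}G_\varepsilon(u,\Omega)$ whenever this limit exists. For $A\in\mathbb R^{m\times n}$ put $\psi(A)=G(l^A,(-\tfrac12,\tfrac12)^n)$, where $l^A(x)=Ax$. **Statement.** Let $\alpha_p$ be a $p$-core functional such that for every $D'\in\mathcal G^D(\mathbb R^n)$ the restriction of $\alpha_p(\cdot,D')$ to $L^p(\mathbb R^n;\mathbb R^m)$ is lower semicontinuous. Then the limit defining $\psi(A)$ exists and is finite for every $A\in\mathbb R^{m\times n}$, and $\mathcal N=\{A:\psi(A)=0\}$ is a linear subspace of $\mathbb R^{m\times n}$. Moreover, for every linear subspace $\mathcal P$ with $\mathbb R^{m\times n}=\mathcal P\oplus\mathcal N$, with $\pi_{\mathcal P}$ the projection onto $\mathcal P$ along $\mathcal N$, there is a constant $C>0$ (depending only on $\psi$ and $\mathcal P$) such that the following holds. Let $\rho\in C_c^\infty(\mathbb R^n)$ be nonnegative and radial, with support in the closed unit ball centred at $0$ and $\int\rho=1$, let $\rho_\sigma(x)=\sigma^{-n}\rho(x/\sigma)$, let $\tilde\Omega\subseteq\Omega\subseteq\mathbb R^n$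 be open sets such that $\overline{\tilde\Omega}$ is compact and contained in $\Omega$, and let $u\in L^p_{\mathrm{loc}}(\mathbb R^n;\mathbb R^m)$. For every $0<\sigma<\operatorname{dist}(\tilde\Omega,\partial\Omega)$ (the distance being $+\infty$ if one of the sets is empty), with $u_\sigma=\rho_\sigma*u$, the limit $G(u_\sigma,\tilde\Omega)$ exists and $$C\int_{\tilde\Omega}|\pi_{\mathcal P}(\nabla u_\sigma)|_2^p\,dx\le\int_{\tilde\Omega}\psi(\nabla u_\sigma)\,dx=G(u_\sigma,\tilde\Omega)\le G_-(u,\Omega).$$ -/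

import Mathlib

open MeasureTheory Filter Topology Set
open scoped ENNReal NNReal

noncomputable section

namespace BMOType

/-- Euclidean space `ℝⁿ`. Real `m × n` matrices are identified with the linear maps
`E n →L[ℝ] E m`, whose norm is the operator norm for the Euclidean norms. -/
abbrev E (n : ℕ) : Type := EuclideanSpace ℝ (Fin n)

/-- The special orthogonal group `SO(n)`. -/
abbrev SO (n : ℕ) : Type := Matrix.specialOrthogonalGroup (Fin n) ℝ

/-- The linear action of a rotation on `ℝⁿ`. -/
def rot {n : ℕ} (R : SO n) (x : E n) : E n :=
  Matrix.toEuclideanLin (R : Matrix (Fin n) (Fin n) ℝ) x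

/-- `u ∈ L^p_loc(ℝⁿ; ℝᵐ)`. -/
def MemLpLoc {n m : ℕ} (p : ℝ≥0∞) (u : E n → E m) : Prop :=
  ∀ K : Set (E n), IsCompact K → MemLp u p (volume.restrict K)

/-- `V` is the weak gradient of `u` on the open set `D`. -/
structure HasWeakGradientOn {n m : ℕ} (u : E n → E m) (V : E n → (E n →L[ℝ] E m))
    (D : Set (E n)) : Prop where
  locallyIntegrable : LocallyIntegrableOn u D
  locallyIntegrable_grad : LocallyIntegrableOn V D
  integral_eq : ∀ φ : E n → ℝ, ContDiff ℝ ((⊤ : ℕ∞) : WithTop ℕ∞) φ → HasCompactSupport φ → tsupport φ ⊆ D →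
    ∀ e : E n, ∫ x in D, (fderiv ℝ φ x e) • u x = - ∫ x in D, φ x • V x e

/-- The sets `F(D) ⊆ Ω`, with `F ∈ Γ`. -/
def images {n : ℕ} (Γ : Set (E n ≃ᵃ[ℝ] E n)) (D Ω : Set (E n)) : Set (Set (E n)) :=
  {D' | D' ⊆ Ω ∧ ∃ F ∈ Γ, D' = F '' D}

/-- `α` is a `p`-core functional with reference set `D`, subordinated to the group `Γ`. Only the
values `α u D'` with `u ∈ L^p_loc(ℝⁿ; ℝᵐ)` and `D'` an image of `D` under `Γ` are relevant. -/
structure IsCoreFunctional {n m : ℕ} (p : ℝ≥0∞) (D : Set (E n))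
    (Γ : Subgroup (E n ≃ᵃ[ℝ] E n)) (α : (E n → E m) → Set (E n) → ℝ≥0) : Prop where
  extension_independent : ∀ D' ∈ images Γ D univ, ∀ u v : E n → E m,
    MemLpLoc p u → MemLpLoc p v → u =ᵐ[volume.restrict D'] v → α u D' = α v D'
  convex : ∀ D' ∈ images Γ D univ, ∀ u v : E n → E m, MemLpLoc p u → MemLpLoc p v →
    ∀ a b : ℝ≥0, a + b = 1 → α ((a : ℝ) • u + (b : ℝ) • v) D' ≤ a * α u D' + b * α v D'
  homogeneous : ∀ D' ∈ images Γ D univ, ∀ u : E n → E m, MemLpLoc p u →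
    ∀ t : ℝ, α (t • u) D' = ‖t‖₊ ^ p.toReal * α u D'
  translation_invariant : ∀ D' ∈ images Γ D univ, ∀ u : E n → E m, MemLpLoc p u →
    ∀ h : E m, α (fun x ↦ u x + h) D' = α u D'
  change_of_variable : ∀ D' ∈ images Γ D univ, ∀ u : E n → E m, MemLpLoc p u →
    ∀ F ∈ Γ, α (u ∘ F) D' = α u (F '' D')
  gradient_bound : ∃ c : ℝ≥0, 0 < c ∧ ∀ u : E n → E m, MemLpLoc p u →
    ∀ V : E n → (E n →L[ℝ] E m), HasWeakGradientOn u V D →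
      MemLp u p (volume.restrict D) → MemLp V p (volume.restrict D) →
      (α u D : ℝ≥0∞) ≤ c * ∫⁻ x in D, ‖V x‖ₑ ^ p.toReal

/-- The maps `x ↦ ε R x + h` with `R ∈ 𝒢` and `h ∈ ℝⁿ`. -/
def similaritiesOfRatio {n : ℕ} (𝒢 : Subgroup (SO n)) (ε : ℝ) : Set (E n ≃ᵃ[ℝ] E n) :=
  {F | ∃ R ∈ 𝒢, ∃ h : E n, ∀ x, F x = ε • rot R x + h}

theorem rot_add {n : ℕ} (R : SO n) (x y : E n) : rot R (x + y) = rot R x + rot R y :=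
  map_add _ _ _

theorem rot_smul {n : ℕ} (R : SO n) (c : ℝ) (x : E n) : rot R (c • x) = c • rot R x :=
  map_smul _ _ _

theorem rot_one {n : ℕ} (x : E n) : rot (1 : SO n) x = x := by
  simp [rot]

theorem rot_mul {n : ℕ} (R S : SO n) (x : E n) : rot (R * S) x = rot R (rot S x) := by
  simp [rot, Matrix.toLpLin_apply, Matrix.mulVec_mulVec]

/-- The group of all maps `x ↦ ε R x + h` with `ε > 0`, `R ∈ 𝒢` and `h ∈ ℝⁿ`. -/
def similarities {n : ℕ} (𝒢 : Subgroup (SO n)) : Subgroup (E n ≃ᵃ[ℝ] E n) where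
  carrier := {F | ∃ ε : ℝ, 0 < ε ∧ F ∈ similaritiesOfRatio 𝒢 ε}
  one_mem' := ⟨1, one_pos, 1, 𝒢.one_mem, 0, fun x ↦ by
    simp [rot_one, AffineEquiv.one_def]⟩
  mul_mem' := by
    rintro F F' ⟨ε, hε, R, hR, h, hF⟩ ⟨ε', hε', R', hR', h', hF'⟩
    refine ⟨ε * ε', mul_pos hε hε', R * R', 𝒢.mul_mem hR hR', ε • rot R h' + h, fun x ↦ ?_⟩
    rw [AffineEquiv.mul_def, AffineEquiv.trans_apply, hF', hF, rot_add, rot_smul, rot_mul,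
      smul_add, smul_smul, add_assoc]
  inv_mem' := by
    rintro F ⟨ε, hε, R, hR, h, hF⟩
    refine ⟨ε⁻¹, inv_pos.2 hε, R⁻¹, 𝒢.inv_mem hR, -(ε⁻¹ • rot R⁻¹ h), fun x ↦ ?_⟩
    rw [AffineEquiv.inv_def]
    obtain ⟨y, rfl⟩ := F.surjective x
    rw [AffineEquiv.symm_apply_apply, hF, rot_add, rot_smul, ← rot_mul, inv_mul_cancel, rot_one,
      smul_add, smul_smul, inv_mul_cancel₀ hε.ne', one_smul, add_neg_cancel_right]

section Seminorm

variable {n m : ℕ} (p : ℝ≥0∞) (D : Set (E n)) (𝒢 : Subgroup (SO n))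
  (α : (E n → E m) → Set (E n) → ℝ≥0)

/-- The BMO-type seminorm `G_ε(u, Ω)`. -/
def G (ε : ℝ) (u : E n → E m) (Ω : Set (E n)) : ℝ≥0∞ :=
  ENNReal.ofReal (ε ^ ((n : ℝ) - p.toReal)) *
    ⨆ (𝓕 : Set (Set (E n))) (_ : 𝓕 ⊆ images (similaritiesOfRatio 𝒢 ε) D Ω)
      (_ : 𝓕.PairwiseDisjoint id), ∑' D' : 𝓕, (α u D' : ℝ≥0∞)

/-- `G₋(u, Ω)`, the lower limit of `G_ε(u, Ω)` as `ε → 0⁺`. -/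
def Gminus (u : E n → E m) (Ω : Set (E n)) : ℝ≥0∞ :=
  liminf (fun ε ↦ G p D 𝒢 α ε u Ω) (𝓝[>] (0 : ℝ))

/-- `G(u, Ω)`, the limit of `G_ε(u, Ω)` as `ε → 0⁺`; meaningful only where this limit exists. -/
def Glim (u : E n → E m) (Ω : Set (E n)) : ℝ≥0∞ :=
  limUnder (𝓝[>] (0 : ℝ)) (fun ε ↦ G p D 𝒢 α ε u Ω)

/-- The open unit cube centred at the origin. -/
def Q (n : ℕ) : Set (E n) := {x | ∀ i, x i ∈ Ioo (-(1 / 2) : ℝ) (1 / 2)}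

/-- The integrand `ψ(A) = G(l^A, Q)`, where `l^A x = A x`. -/
def psi (A : E n →L[ℝ] E m) : ℝ≥0∞ := Glim p D 𝒢 α (fun x ↦ A x) (Q n)

end Seminorm

/-- Standard radial mollification kernels on `ℝⁿ`. -/
structure IsStandardMollifier {n : ℕ} (ρ : E n → ℝ) : Prop where
  contDiff : ContDiff ℝ ((⊤ : ℕ∞) : WithTop ℕ∞) ρ
  nonneg : ∀ x, 0 ≤ ρ x
  radial : ∀ x y, ‖x‖ = ‖y‖ → ρ x = ρ y
  tsupport_subset : tsupport ρ ⊆ Metric.closedBall 0 1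
  integral_eq_one : ∫ x, ρ x = 1

/-- The rescaled kernel `ρ_σ(x) = σ⁻ⁿ ρ(x / σ)`. -/
def rescale {n : ℕ} (ρ : E n → ℝ) (σ : ℝ) (x : E n) : ℝ := (σ ^ n)⁻¹ * ρ (σ⁻¹ • x)

/-- The mollification `ρ_σ * u`. -/
def mollify {n m : ℕ} (ρ : E n → ℝ) (σ : ℝ) (u : E n → E m) : E n → E m :=
  convolution (rescale ρ σ) u (ContinuousLinearMap.lsmul ℝ ℝ) volume

/-- The distance between two sets, equal to `∞` if one of them is empty. -/
def setDist {n : ℕ} (S T : Set (E n)) : ℝ≥0∞ := ⨅ (x ∈ S) (y ∈ T), edist x y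

end BMOType

end

/-! At fixed scale `ε` three properties of `G` carry the proof. It is superadditive over disjoint
regions, because packings can be united (`sum_G_le_of_disjoint`). For `C¹` maps it is at most `c ∫
|∇u|^p` with `c` independent of `ε`, which is what the factor `ε^(n-p)` is for
(`exists_isGradientBound`). Convexity and `p`-homogeneity give `G(u+v) ≤ a G(u) + b G(v)` with `a >
1` as close to 1 as desired, at the price of a large `b` (`exists_G_add_le`).

For a linear map, a homothety turns `G` at scale `ε` on a cube of side `r` into `r^n` times `G` at
scale `ε/r` on `Q`. Filling `Q` with small copies of itself shows that the limit defining `ψ` exists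
and is a supremum over all scales (`tendsto_G_linear_iSup`). The three properties then make `ψ`
finite, continuous and `p`-homogeneous, its null set a subspace, and its minimum on the unit sphere
of `P` positive; that minimum is the constant `C` (`exists_mul_enorm_projection_le`).

For `C¹` maps `v` on a bounded open set, `G(v) = ∫ ψ(∇v)` (`tendsto_G_of_contDiff`): fill the set,
up to small measure, with finitely many disjoint cubes on which `∇v` is nearly constant, and replace
`v` by its linear part on each. Superadditivity gives the lower bound. For the upper bound, once `ε`
is small every packing element lies in a cube or avoids all slightly shrunken cubes, and the
gradient bound makes the latter contribution small.

Finally, mollification does not increase `G`, at each fixed `ε` (`G_mollify_le`). For a finite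
packing the sublevel set of the sum of the `α(·, D')` is convex, and closed in `L^p` by lower
semicontinuity. It contains the translates of `u` by vectors of length at most `σ`, hence also their
average `ρ_σ * u`. Taking lower limits in `ε` concludes. -/

noncomputable section

namespace BMOType

variable {n m : ℕ} {p : ℝ≥0∞} {D : Set (E n)} {𝒢 : Subgroup (SO n)}
  {α : (E n → E m) → Set (E n) → ℝ≥0} {ε : ℝ} {u v : E n → E m} {Ω Ω' : Set (E n)}

/-! ### Closure properties of `L^p_loc` -/

theorem MemLpLoc.add (hu : MemLpLoc p u) (hv : MemLpLoc p v) : MemLpLoc p (u + v) :=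
  fun K hK ↦ (hu K hK).add (hv K hK)

theorem MemLpLoc.const_smul (hu : MemLpLoc p u) (t : ℝ) : MemLpLoc p (t • u) :=
  fun K hK ↦ (hu K hK).const_smul t

theorem memLp_restrict_of_continuous {F : Type*} [NormedAddCommGroup F]
    [SecondCountableTopologyEither (E n) F] {f : E n → F} (hf : Continuous f)
    {K : Set (E n)} (hK : Bornology.IsBounded K) : MemLp f p (volume.restrict K) := by
  have hc := hK.isCompact_closure
  have : IsFiniteMeasure (volume.restrict (closure K)) := ⟨by simpa using hc.measure_lt_top⟩
  obtain ⟨C, hC⟩ := hc.exists_bound_of_continuousOn hf.continuousOn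
  have : MemLp f p (volume.restrict (closure K)) :=
    MemLp.of_bound hf.aestronglyMeasurable C
      ((ae_restrict_iff' hc.measurableSet).2 (ae_of_all _ hC))
  exact this.mono_measure (Measure.restrict_mono_set _ subset_closure)

theorem MemLpLoc.of_continuous (hu : Continuous u) : MemLpLoc p u :=
  fun _ hK ↦ memLp_restrict_of_continuous hu hK.isBounded

theorem MemLpLoc.locallyIntegrable (hp : 1 ≤ p) (hu : MemLpLoc p u) :
    LocallyIntegrable u volume := by
  rw [locallyIntegrable_iff]
  intro K hK
  have : IsFiniteMeasure (volume.restrict K) := ⟨by simpa using hK.measure_lt_top⟩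
  exact (hu K hK).integrable hp

/-! ### Homotheties -/

/-- The map `x ↦ r x + h`. -/
def homothety (r : ℝ) (hr : r ≠ 0) (h : E n) : E n ≃ᵃ[ℝ] E n :=
  (LinearEquiv.smulOfNeZero ℝ (E n) r hr).toAffineEquiv.trans (AffineEquiv.constVAdd ℝ (E n) h)

@[simp]
theorem homothety_apply (r : ℝ) (hr : r ≠ 0) (h x : E n) :
    homothety r hr h x = r • x + h := by
  simp [homothety, add_comm]

theorem homothety_mul_mem {r : ℝ} (hr : 0 < r) (h : E n) {F : E n ≃ᵃ[ℝ] E n}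
    (hF : F ∈ similaritiesOfRatio 𝒢 ε) :
    homothety r hr.ne' h * F ∈ similaritiesOfRatio 𝒢 (r * ε) := by
  obtain ⟨R, hR, k, hF⟩ := hF
  refine ⟨R, hR, r • k + h, fun x ↦ ?_⟩
  simp [AffineEquiv.mul_def, hF, smul_smul, add_assoc]

theorem mem_similaritiesOfRatio_homothety {r : ℝ} (hr : 0 < r) (h : E n) :
    homothety r hr.ne' h ∈ similaritiesOfRatio 𝒢 r :=
  ⟨1, 𝒢.one_mem, h, fun x ↦ by simp [rot_one]⟩

theorem homothety_mem_similarities {r : ℝ} (hr : 0 < r) (h : E n) :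
    homothety r hr.ne' h ∈ similarities 𝒢 :=
  ⟨r, hr, mem_similaritiesOfRatio_homothety hr h⟩

theorem MemLpLoc.comp_homothety (hu : MemLpLoc p u) {r : ℝ} (hr : 0 < r) (h : E n) :
    MemLpLoc p (u ∘ homothety r hr.ne' h) := by
  intro K hK
  set g := homothety r hr.ne' h
  have hg : Continuous g := by
    have : (g : E n → E n) = fun x ↦ r • x + h := by ext1 x; simp [g]
    rw [this]; fun_prop
  have hgK : IsCompact (g '' K) := hK.image hg
  have hgm : MeasurableEmbedding g := by
    have : (g : E n → E n) = (Homeomorph.addRight h) ∘ (Homeomorph.smulOfNeZero r hr.ne') := by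
      ext1 x; simp [g]
    rw [this]
    exact (Homeomorph.measurableEmbedding _).comp (Homeomorph.measurableEmbedding _)
  have hmap : Measure.map g (volume.restrict K) =
      ENNReal.ofReal |(r ^ n)⁻¹| • volume.restrict (g '' K) := by
    have h1 : Measure.map g volume = ENNReal.ofReal |(r ^ n)⁻¹| • (volume : Measure (E n)) := by
      have : (g : E n → E n) = (fun x ↦ x + h) ∘ (fun x ↦ r • x) := by
        ext1 x; simp [g]
      rw [this, ← Measure.map_map (by fun_prop) (by fun_prop), Measure.map_addHaar_smul _ hr.ne',
        Measure.map_smul, map_add_right_eq_self]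
      simp
    have h2 : K = g ⁻¹' (g '' K) := (preimage_image_eq _ g.injective).symm
    conv_lhs => rw [h2]
    rw [← hgm.restrict_map, h1, Measure.restrict_smul]
  have := (hu _ hgK).smul_measure (c := ENNReal.ofReal |(r ^ n)⁻¹|) (by simp)
  rw [← hmap] at this
  exact (hgm.memLp_map_measure_iff).1 this

/-! ### Families of images of the reference set -/

theorem images_mono {Γ : Set (E n ≃ᵃ[ℝ] E n)} (h : Ω ⊆ Ω') : images Γ D Ω ⊆ images Γ D Ω' :=
  fun _ hD ↦ ⟨hD.1.trans h, hD.2⟩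

theorem images_subset_images_similarities (hε : 0 < ε) :
    images (similaritiesOfRatio 𝒢 ε) D Ω ⊆ images (similarities 𝒢 : Set _) D univ :=
  fun _ hD ↦ ⟨subset_univ _, hD.2.imp fun _ hF ↦ ⟨⟨ε, hε, hF.1⟩, hF.2⟩⟩

theorem self_mem_images_similarities : D ∈ images (similarities 𝒢 : Set _) D univ :=
  ⟨subset_univ _, 1, (similarities 𝒢).one_mem, by simp⟩

theorem image_homothety_mem_images {r : ℝ} (hr : 0 < r) (h : E n) {D' : Set (E n)}
    (hD' : D' ∈ images (similaritiesOfRatio 𝒢 ε) D Ω) :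
    homothety r hr.ne' h '' D' ∈
      images (similaritiesOfRatio 𝒢 (r * ε)) D (homothety r hr.ne' h '' Ω) := by
  obtain ⟨h1, F, hF, rfl⟩ := hD'
  refine ⟨image_mono h1, _, homothety_mul_mem hr h hF, ?_⟩
  rw [image_image]; rfl

/-- A finite family of pairwise disjoint elements of `𝒢^D_ε(Ω)`. -/
structure IsPacking (D : Set (E n)) (𝒢 : Subgroup (SO n)) (ε : ℝ) (Ω : Set (E n))
    (s : Finset (Set (E n))) : Prop where
  subset_images : ∀ D' ∈ s, D' ∈ images (similaritiesOfRatio 𝒢 ε) D Ω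
  disjoint : (s : Set (Set (E n))).PairwiseDisjoint id

theorem IsPacking.mono {s : Finset (Set (E n))} (hs : IsPacking D 𝒢 ε Ω s) (h : Ω ⊆ Ω') :
    IsPacking D 𝒢 ε Ω' s :=
  ⟨fun D' hD' ↦ images_mono h (hs.1 D' hD'), hs.2⟩

theorem IsPacking.subset {s t : Finset (Set (E n))} (hs : IsPacking D 𝒢 ε Ω s) (h : t ⊆ s) :
    IsPacking D 𝒢 ε Ω t :=
  ⟨fun D' hD' ↦ hs.1 D' (h hD'), hs.2.subset (by exact_mod_cast h)⟩

theorem IsPacking.sum_le_G {s : Finset (Set (E n))} (hs : IsPacking D 𝒢 ε Ω s) :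
    ENNReal.ofReal (ε ^ ((n : ℝ) - p.toReal)) * ∑ D' ∈ s, (α u D' : ℝ≥0∞) ≤ G p D 𝒢 α ε u Ω := by
  unfold G
  gcongr
  refine le_iSup_of_le (s : Set (Set (E n))) (le_iSup_of_le hs.1 (le_iSup_of_le hs.2 ?_))
  rw [Finset.tsum_subtype' s (fun D' ↦ (α u D' : ℝ≥0∞))]

/-- A sum in `ℝ≥0∞` is the supremum of its finite partial sums, so finite packings suffice. The
sublevel-set argument for mollification needs finite sums. -/
theorem G_le {B : ℝ≥0∞} (h : ∀ s : Finset (Set (E n)), IsPacking D 𝒢 ε Ω s →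
    ENNReal.ofReal (ε ^ ((n : ℝ) - p.toReal)) * ∑ D' ∈ s, (α u D' : ℝ≥0∞) ≤ B) :
    G p D 𝒢 α ε u Ω ≤ B := by
  classical
  unfold G
  simp only [ENNReal.mul_iSup, iSup_le_iff, ENNReal.tsum_eq_iSup_sum]
  intro 𝓕 h𝓕 hd s
  have := h (s.image Subtype.val) ⟨?_, ?_⟩
  · rwa [Finset.sum_image Subtype.val_injective.injOn] at this
  · simp only [Finset.mem_image]
    rintro _ ⟨D', -, rfl⟩
    exact h𝓕 D'.2
  · refine hd.subset ?_
    simp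

theorem G_mono (h : Ω ⊆ Ω') : G p D 𝒢 α ε u Ω ≤ G p D 𝒢 α ε u Ω' :=
  G_le fun _ hs ↦ (hs.mono h).sum_le_G

/-- On the empty set `u` agrees a.e. with `0 • u`, so homogeneity applies. This covers an empty `D`,
the only case in which packings of disjoint regions can share an element. -/
theorem alpha_empty (hp : 1 ≤ p) (hp' : p ≠ ∞) (hα : IsCoreFunctional p D (similarities 𝒢) α)
    (h : ∅ ∈ images (similarities 𝒢 : Set _) D univ) (hu : MemLpLoc p u) : α u ∅ = 0 := by
  have h0 : MemLpLoc p ((0 : ℝ) • u) := hu.const_smul 0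
  rw [hα.extension_independent _ h u _ hu h0 (by simp [Filter.EventuallyEq]), hα.homogeneous _ h u hu 0]
  have : p.toReal ≠ 0 := (ENNReal.toReal_pos (one_pos.trans_le hp).ne' hp').ne'
  simp [NNReal.zero_rpow this]

/-- The union of packings of the two regions is a packing of `Ω`. The two suprema are then taken one
after the other, by subtraction, which is why the infinite case is split off. -/
theorem G_add_le_of_disjoint (hp : 1 ≤ p) (hp' : p ≠ ∞)
    (hα : IsCoreFunctional p D (similarities 𝒢) α)
    (hε : 0 < ε) (hu : MemLpLoc p u) {Ω₁ Ω₂ : Set (E n)} (h₁ : Ω₁ ⊆ Ω) (h₂ : Ω₂ ⊆ Ω)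
    (hd : Disjoint Ω₁ Ω₂) :
    G p D 𝒢 α ε u Ω₁ + G p D 𝒢 α ε u Ω₂ ≤ G p D 𝒢 α ε u Ω := by
  classical
  by_cases htop : G p D 𝒢 α ε u Ω = ∞
  · simp [htop]
  have key : ∀ s t, IsPacking D 𝒢 ε Ω₁ s → IsPacking D 𝒢 ε Ω₂ t →
      ENNReal.ofReal (ε ^ ((n : ℝ) - p.toReal)) * ∑ D' ∈ s, (α u D' : ℝ≥0∞) +
      ENNReal.ofReal (ε ^ ((n : ℝ) - p.toReal)) * ∑ D' ∈ t, (α u D' : ℝ≥0∞) ≤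
        G p D 𝒢 α ε u Ω := by
    intro s t hs ht
    have hst : IsPacking D 𝒢 ε Ω (s ∪ t) := by
      refine ⟨fun D' hD' ↦ ?_, ?_⟩
      · rcases Finset.mem_union.1 hD' with h | h
        exacts [images_mono h₁ (hs.1 _ h), images_mono h₂ (ht.1 _ h)]
      · rw [Finset.coe_union]
        refine (pairwiseDisjoint_union).2 ⟨hs.2, ht.2, fun A hA B hB _ ↦ ?_⟩
        exact hd.mono (hs.1 A hA).1 (ht.1 B hB).1
    rw [← mul_add, ← Finset.sum_union_inter, Finset.sum_eq_zero (s := s ∩ t), add_zero]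
    · exact hst.sum_le_G
    · intro D' hD'
      rw [Finset.mem_inter] at hD'
      have : D' = ∅ := by
        have := hd.mono (hs.1 D' hD'.1).1 (ht.1 D' hD'.2).1
        simpa using this
      subst this
      rw [alpha_empty hp hp' hα (images_subset_images_similarities hε (hs.1 _ hD'.1)) hu]
      simp
  have hle : G p D 𝒢 α ε u Ω₁ ≤ G p D 𝒢 α ε u Ω - G p D 𝒢 α ε u Ω₂ := by
    refine G_le fun s hs ↦ ?_
    refine ENNReal.le_sub_of_add_le_left (ne_top_of_le_ne_top htop (G_mono h₂)) ?_
    have hb : ENNReal.ofReal (ε ^ ((n : ℝ) - p.toReal)) * ∑ D' ∈ s, (α u D' : ℝ≥0∞) ≠ ∞ :=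
      ne_top_of_le_ne_top htop (hs.mono h₁).sum_le_G
    have : G p D 𝒢 α ε u Ω₂ ≤ G p D 𝒢 α ε u Ω -
        ENNReal.ofReal (ε ^ ((n : ℝ) - p.toReal)) * ∑ D' ∈ s, (α u D' : ℝ≥0∞) := by
      refine G_le fun t ht ↦ ?_
      exact ENNReal.le_sub_of_add_le_left hb (key s t hs ht)
    exact (add_le_of_le_tsub_right_of_le ((hs.mono h₁).sum_le_G) this)
  exact add_le_of_le_tsub_right_of_le (G_mono h₂) hle

theorem sum_G_le_of_disjoint (hp : 1 ≤ p) (hp' : p ≠ ∞)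
    (hα : IsCoreFunctional p D (similarities 𝒢) α)
    (hε : 0 < ε) (hu : MemLpLoc p u) {ι : Type*} (s : Finset ι) (A : ι → Set (E n))
    (hA : ∀ i ∈ s, A i ⊆ Ω) (hd : (s : Set ι).PairwiseDisjoint A) :
    ∑ i ∈ s, G p D 𝒢 α ε u (A i) ≤ G p D 𝒢 α ε u Ω := by
  classical
  induction s using Finset.induction_on generalizing Ω with
  | empty => simp
  | insert i s hi ih =>
    rw [Finset.sum_insert hi]
    have h1 : ∑ j ∈ s, G p D 𝒢 α ε u (A j) ≤ G p D 𝒢 α ε u (⋃ j ∈ s, A j) :=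
      ih (fun j hj ↦ subset_biUnion_of_mem (u := A) hj)
        (hd.subset (by simp))
    refine (add_le_add_right h1 _).trans (G_add_le_of_disjoint hp hp' hα hε hu
      (hA i (by simp)) (iUnion₂_subset fun j hj ↦ hA j (by simp [hj])) ?_)
    refine disjoint_iUnion₂_right.2 fun j hj ↦ hd (by simp) (by simp [hj]) ?_
    rintro rfl
    exact hi hj

/-! ### Quasi-triangle inequality and homogeneity -/

/-- Write `u + v = t (u/t) + s (v/s)` with `t + s = 1`. Convexity and homogeneity give the factors
`t^(1-p)` and `s^(1-p)`, and the first tends to 1 as `t → 1⁻`. -/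
theorem exists_alpha_add_le (hα : IsCoreFunctional p D (similarities 𝒢) α) {a : ℝ≥0} (ha : 1 < a) :
    ∃ b : ℝ≥0, ∀ D' ∈ images (similarities 𝒢 : Set _) D univ, ∀ u v : E n → E m,
      MemLpLoc p u → MemLpLoc p v → α (u + v) D' ≤ a * α u D' + b * α v D' := by
  have hlim : Tendsto (fun t : ℝ≥0 ↦ t * (t⁻¹) ^ p.toReal) (𝓝[<] 1) (𝓝 1) := by
    have : ContinuousAt (fun t : ℝ≥0 ↦ t * (t⁻¹) ^ p.toReal) 1 := by
      refine continuousAt_id.mul ?_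
      exact (NNReal.continuousAt_rpow_const (by simp)).comp (continuousAt_inv₀ one_ne_zero)
    simpa using this.tendsto.mono_left (nhdsWithin_le_nhds (s := Iio 1))
  have hpos : ∀ᶠ t : ℝ≥0 in 𝓝[<] 1, 0 < t :=
    nhdsWithin_le_nhds (lt_mem_nhds one_pos)
  have : (𝓝[<] (1 : ℝ≥0)).NeBot := nhdsLT_neBot_of_exists_lt ⟨0, one_pos⟩
  obtain ⟨t, hta, ht1, ht0⟩ :=
    (((tendsto_order.1 hlim).2 a ha).and (eventually_mem_nhdsWithin.and hpos)).exists
  have ht1 : t < 1 := ht1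
  obtain ⟨s, hs⟩ : ∃ s, t + s = 1 := ⟨1 - t, add_tsub_cancel_of_le ht1.le⟩
  have hs0 : s ≠ 0 := by rintro rfl; simp at hs; exact ht1.ne hs
  refine ⟨s * (s⁻¹) ^ p.toReal, fun D' hD' u v hu hv ↦ ?_⟩
  have h := hα.convex D' hD' _ _ (hu.const_smul (t⁻¹ : ℝ≥0)) (hv.const_smul (s⁻¹ : ℝ≥0)) t s hs
  rw [hα.homogeneous D' hD' u hu, hα.homogeneous D' hD' v hv, smul_smul, smul_smul,
    ← NNReal.coe_mul, ← NNReal.coe_mul, mul_inv_cancel₀ ht0.ne', mul_inv_cancel₀ hs0] at h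
  simp only [NNReal.coe_one, one_smul, NNReal.nnnorm_eq, ← mul_assoc] at h
  refine h.trans ?_
  gcongr

theorem exists_G_add_le (hα : IsCoreFunctional p D (similarities 𝒢) α) {a : ℝ≥0} (ha : 1 < a) :
    ∃ b : ℝ≥0, ∀ ε : ℝ, 0 < ε → ∀ (Ω : Set (E n)) (u v : E n → E m),
      MemLpLoc p u → MemLpLoc p v →
        G p D 𝒢 α ε (u + v) Ω ≤ a * G p D 𝒢 α ε u Ω + b * G p D 𝒢 α ε v Ω := by
  obtain ⟨b, hb⟩ := exists_alpha_add_le hα ha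
  refine ⟨b, fun ε hε Ω u v hu hv ↦ G_le fun s hs ↦ ?_⟩
  calc _ ≤ ENNReal.ofReal (ε ^ ((n : ℝ) - p.toReal)) *
          ∑ D' ∈ s, ((a : ℝ≥0∞) * α u D' + b * α v D') := by
        gcongr with D' hD'
        exact_mod_cast hb D' (images_subset_images_similarities hε (hs.1 D' hD')) u v hu hv
    _ = a * (ENNReal.ofReal (ε ^ ((n : ℝ) - p.toReal)) * ∑ D' ∈ s, (α u D' : ℝ≥0∞)) +
        b * (ENNReal.ofReal (ε ^ ((n : ℝ) - p.toReal)) * ∑ D' ∈ s, (α v D' : ℝ≥0∞)) := by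
        rw [Finset.sum_add_distrib, ← Finset.mul_sum, ← Finset.mul_sum]
        ring
    _ ≤ _ := by gcongr <;> exact hs.sum_le_G

theorem G_congr (h : ∀ D' ∈ images (similaritiesOfRatio 𝒢 ε) D Ω, α u D' = α v D') :
    G p D 𝒢 α ε u Ω = G p D 𝒢 α ε v Ω := by
  refine le_antisymm (G_le fun s hs ↦ ?_) (G_le fun s hs ↦ ?_)
  · rw [Finset.sum_congr rfl fun D' hD' ↦ by rw [h D' (hs.1 D' hD')]]
    exact hs.sum_le_G
  · rw [Finset.sum_congr rfl fun D' hD' ↦ by rw [← h D' (hs.1 D' hD')]]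
    exact hs.sum_le_G

theorem G_smul (hα : IsCoreFunctional p D (similarities 𝒢) α) (hε : 0 < ε) (hu : MemLpLoc p u)
    (t : ℝ) : G p D 𝒢 α ε (t • u) Ω = ‖t‖ₑ ^ p.toReal * G p D 𝒢 α ε u Ω := by
  have : ∀ D' ∈ images (similaritiesOfRatio 𝒢 ε) D Ω,
      (α (t • u) D' : ℝ≥0∞) = ‖t‖ₑ ^ p.toReal * α u D' := by
    intro D' hD'
    rw [hα.homogeneous D' (images_subset_images_similarities hε hD') u hu, ENNReal.coe_mul,
      ENNReal.coe_rpow_of_nonneg _ ENNReal.toReal_nonneg]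
    rfl
  have hG : ∀ w : E n → E m, G p D 𝒢 α ε w Ω = ⨆ s : {s // IsPacking D 𝒢 ε Ω s},
      ENNReal.ofReal (ε ^ ((n : ℝ) - p.toReal)) * ∑ D' ∈ s.1, (α w D' : ℝ≥0∞) := fun w ↦
    le_antisymm (G_le fun s hs ↦ le_iSup_of_le ⟨s, hs⟩ le_rfl) (iSup_le fun s ↦ s.2.sum_le_G)
  rw [hG, hG, ENNReal.mul_iSup]
  congr 1 with s
  rw [Finset.sum_congr rfl fun D' hD' ↦ this D' (s.2.1 D' hD'), ← Finset.mul_sum]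
  ring

theorem G_add_const (hα : IsCoreFunctional p D (similarities 𝒢) α) (hε : 0 < ε)
    (hu : MemLpLoc p u) (h : E m) :
    G p D 𝒢 α ε (fun x ↦ u x + h) Ω = G p D 𝒢 α ε u Ω :=
  G_congr fun D' hD' ↦
    hα.translation_invariant D' (images_subset_images_similarities hε hD') u hu h

/-! ### Behaviour under homotheties -/

theorem G_comp_homothety_le (hα : IsCoreFunctional p D (similarities 𝒢) α) (hε : 0 < ε)
    (hu : MemLpLoc p u) {r : ℝ} (hr : 0 < r) (h : E n) :
    ENNReal.ofReal (r ^ ((n : ℝ) - p.toReal)) * G p D 𝒢 α ε (u ∘ homothety r hr.ne' h) Ω ≤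
      G p D 𝒢 α (r * ε) u (homothety r hr.ne' h '' Ω) := by
  classical
  set g := homothety r hr.ne' h
  have h0 : ENNReal.ofReal (r ^ ((n : ℝ) - p.toReal)) ≠ 0 := by
    simpa using Real.rpow_pos_of_pos hr _
  rw [mul_comm, ← ENNReal.le_div_iff_mul_le (.inl h0) (.inl ENNReal.ofReal_ne_top)]
  refine G_le fun s hs ↦ ?_
  rw [ENNReal.le_div_iff_mul_le (.inl h0) (.inl ENNReal.ofReal_ne_top)]
  have hinj : Function.Injective (fun D' : Set (E n) ↦ g '' D') := g.injective.image_injective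
  have hs' : IsPacking D 𝒢 (r * ε) (g '' Ω) (s.image fun D' ↦ g '' D') := by
    refine ⟨?_, ?_⟩
    · simp only [Finset.mem_image]
      rintro _ ⟨D', hD', rfl⟩
      exact image_homothety_mem_images hr h (hs.1 D' hD')
    · rw [Finset.coe_image, hinj.injOn.pairwiseDisjoint_image]
      intro A hA B hB hAB
      exact (disjoint_image_iff g.injective).2 (hs.2 hA hB hAB)
  convert hs'.sum_le_G (α := α) (u := u) (p := p) using 1
  rw [Finset.sum_image hinj.injOn, Finset.sum_congr rfl fun D' hD' ↦ by
    rw [hα.change_of_variable D' (images_subset_images_similarities hε (hs.1 D' hD')) u hu g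
      (homothety_mem_similarities hr h)], Real.mul_rpow hr.le hε.le,
    ENNReal.ofReal_mul (by positivity)]
  ring

/-- Composing a linear map with the homothety multiplies it by `r` up to a constant. The resulting
`r^p` and the normalisation `r^(n-p)` combine to `r^n`. -/
theorem G_linear_homothety_le (hα : IsCoreFunctional p D (similarities 𝒢) α) (hε : 0 < ε)
    (A : E n →L[ℝ] E m) {r : ℝ} (hr : 0 < r) (h : E n) :
    ENNReal.ofReal (r ^ n) * G p D 𝒢 α ε (fun x ↦ A x) Ω ≤
      G p D 𝒢 α (r * ε) (fun x ↦ A x) (homothety r hr.ne' h '' Ω) := by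
  have hA : MemLpLoc p (fun x ↦ A x) := .of_continuous A.continuous
  refine le_trans (le_of_eq ?_) (G_comp_homothety_le hα hε hA hr h)
  have : (fun x ↦ A x) ∘ homothety r hr.ne' h = fun x ↦ (r • fun x ↦ A x) x + A h := by
    ext1 x; simp
  rw [this, G_add_const hα hε (hA.const_smul r), G_smul hα hε hA, ← mul_assoc]
  congr 1
  rw [Real.enorm_of_nonneg hr.le, ENNReal.ofReal_rpow_of_pos hr,
    ← ENNReal.ofReal_mul (by positivity), ← Real.rpow_add hr, sub_add_cancel, Real.rpow_natCast]

theorem G_linear_homothety (hα : IsCoreFunctional p D (similarities 𝒢) α) (hε : 0 < ε)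
    (A : E n →L[ℝ] E m) {r : ℝ} (hr : 0 < r) (h : E n) :
    G p D 𝒢 α (r * ε) (fun x ↦ A x) (homothety r hr.ne' h '' Ω) =
      ENNReal.ofReal (r ^ n) * G p D 𝒢 α ε (fun x ↦ A x) Ω := by
  refine le_antisymm ?_ (G_linear_homothety_le hα hε A hr h)
  have := G_linear_homothety_le hα (mul_pos hr hε) A (inv_pos.2 hr) (-(r⁻¹ • h))
    (Ω := homothety r hr.ne' h '' Ω)
  rw [image_image, inv_mul_cancel_left₀ hr.ne'] at this
  have h2 : (fun x ↦ homothety r⁻¹ (inv_pos.2 hr).ne' (-(r⁻¹ • h)) (homothety r hr.ne' h x)) =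
      fun x : E n ↦ x := by
    ext1 x; simp [smul_smul, inv_mul_cancel₀ hr.ne']
  rw [h2, image_id'] at this
  calc _ = ENNReal.ofReal (r ^ n) * (ENNReal.ofReal (r⁻¹ ^ n) *
        G p D 𝒢 α (r * ε) (fun x ↦ A x) (homothety r hr.ne' h '' Ω)) := by
        rw [← mul_assoc, ← ENNReal.ofReal_mul (by positivity), ← mul_pow, mul_inv_cancel₀ hr.ne']
        simp
    _ ≤ _ := by gcongr

/-! ### The gradient bound for functions of class `C¹` -/

theorem norm_rot (R : SO n) (x : E n) : ‖rot R x‖ = ‖x‖ := by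
  have hR : star (R : Matrix (Fin n) (Fin n) ℝ) * (R : Matrix (Fin n) (Fin n) ℝ) = 1 :=
    Matrix.mem_orthogonalGroup_iff' (Fin n) ℝ |>.1 (Matrix.mem_specialOrthogonalGroup_iff.1 R.2).1
  have key : ∀ y : E n, ‖y‖ ^ 2 = y.ofLp ⬝ᵥ y.ofLp := fun y ↦ by
    rw [EuclideanSpace.norm_sq_eq]; simp [dotProduct, sq, -mul_eq_mul_left_iff]
  rw [← sq_eq_sq₀ (norm_nonneg _) (norm_nonneg _), key, key]
  simp only [rot, Matrix.ofLp_toLpLin, Matrix.toLin'_apply]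
  rw [Matrix.dotProduct_mulVec, Matrix.vecMul_mulVec,
    ← Matrix.conjTranspose_eq_transpose_of_trivial, ← Matrix.star_eq_conjTranspose, hR,
    Matrix.vecMul_one]

/-- A rotation as a continuous linear map. -/
def rotCLM (R : SO n) : E n →L[ℝ] E n :=
  LinearMap.toContinuousLinearMap (Matrix.toEuclideanLin (R : Matrix (Fin n) (Fin n) ℝ))

@[simp]
theorem rotCLM_apply (R : SO n) (x : E n) : rotCLM R x = rot R x := rfl

theorem norm_rotCLM_le (R : SO n) : ‖rotCLM R‖ ≤ 1 :=
  ContinuousLinearMap.opNorm_le_bound _ zero_le_one fun x ↦ by simp [norm_rot]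

theorem det_rotCLM (R : SO n) : (rotCLM R).det = 1 := by
  have : (R : Matrix (Fin n) (Fin n) ℝ).det = 1 := (Matrix.mem_specialOrthogonalGroup_iff.1 R.2).2
  simp [rotCLM, ContinuousLinearMap.det, this]

theorem hasWeakGradientOn_of_contDiff (hu : ContDiff ℝ 1 u) :
    HasWeakGradientOn u (fderiv ℝ u) D where
  locallyIntegrable := hu.continuous.locallyIntegrable.locallyIntegrableOn D
  locallyIntegrable_grad :=
    (hu.continuous_fderiv one_ne_zero).locallyIntegrable.locallyIntegrableOn D
  integral_eq φ hφ hc hD e := by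
    have hφ' : Continuous (fderiv ℝ φ) := hφ.continuous_fderiv (by simp)
    have hu' : Continuous (fderiv ℝ u) := hu.continuous_fderiv one_ne_zero
    have h0 : ∀ x, x ∉ D → φ x = 0 := fun x hx ↦ image_eq_zero_of_notMem_tsupport fun h ↦ hx (hD h)
    have h1 : ∀ x, x ∉ D → fderiv ℝ φ x = 0 := fun x hx ↦
      image_eq_zero_of_notMem_tsupport fun h ↦ hx (hD (tsupport_fderiv_subset ℝ h))
    rw [setIntegral_eq_integral_of_forall_compl_eq_zero fun x hx ↦ by simp [h1 x hx],
      setIntegral_eq_integral_of_forall_compl_eq_zero fun x hx ↦ by simp [h0 x hx],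
      integral_smul_fderiv_eq_neg_fderiv_smul_of_integrable, neg_neg]
    · exact Continuous.integrable_of_hasCompactSupport
        ((hφ'.clm_apply continuous_const).smul hu.continuous)
        (((hc.fderiv ℝ).comp_left (g := fun L : E n →L[ℝ] ℝ ↦ L e) rfl).smul_right)
    · exact Continuous.integrable_of_hasCompactSupport
        (hφ.continuous.smul (hu'.clm_apply continuous_const)) hc.smul_right
    · exact Continuous.integrable_of_hasCompactSupport
        (hφ.continuous.smul hu.continuous) hc.smul_right
    · exact fun x _ ↦ hφ.differentiable (by simp) x
    · exact fun x _ ↦ hu.differentiable one_ne_zero x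

/-- Pull `u` back to `D` by the similarity `F` and apply the gradient bound there. The gradient
gains at most a factor `ε` and the Jacobian is `ε^n`, so `ε^(n-p) ε^p = ε^n` makes the constant
independent of the scale. -/
theorem exists_alpha_le_lintegral (hD : IsOpen D) (hDb : Bornology.IsBounded D)
    (hα : IsCoreFunctional p D (similarities 𝒢) α) :
    ∃ c : ℝ≥0, ∀ ε : ℝ, 0 < ε → ∀ D' ∈ images (similaritiesOfRatio 𝒢 ε) D univ,
      ∀ u : E n → E m, ContDiff ℝ 1 u →
        ENNReal.ofReal (ε ^ ((n : ℝ) - p.toReal)) * (α u D' : ℝ≥0∞) ≤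
          c * ∫⁻ x in D', ‖fderiv ℝ u x‖ₑ ^ p.toReal := by
  obtain ⟨c, -, hc⟩ := hα.gradient_bound
  refine ⟨c, ?_⟩
  rintro ε hε _ ⟨-, F, ⟨R, hR, h, hF⟩, rfl⟩ u hu
  have hu0 : MemLpLoc p u := .of_continuous hu.continuous
  rw [← hα.change_of_variable D self_mem_images_similarities u hu0 F ⟨ε, hε, R, hR, h, hF⟩]
  have hF' : ∀ x, HasFDerivAt F (ε • rotCLM R) x := fun x ↦ by
    have : (F : E n → E n) = fun x ↦ (ε • rotCLM R) x + h := by ext1 x; simp [hF]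
    rw [this]
    exact (ε • rotCLM R).hasFDerivAt.add_const h
  have hFc : ContDiff ℝ 1 F := by
    have : (F : E n → E n) = fun x ↦ (ε • rotCLM R) x + h := by ext1 x; simp [hF]
    rw [this]
    exact (ε • rotCLM R).contDiff.add contDiff_const
  have huF : ContDiff ℝ 1 (u ∘ F) := hu.comp hFc
  have hd : ∀ x, fderiv ℝ (u ∘ F) x = (fderiv ℝ u (F x)).comp (ε • rotCLM R) := fun x ↦
    ((hu.differentiable one_ne_zero _).hasFDerivAt.comp x (hF' x)).fderiv
  have hdn : ∀ x, ‖fderiv ℝ (u ∘ F) x‖ₑ ≤ ENNReal.ofReal ε * ‖fderiv ℝ u (F x)‖ₑ := fun x ↦ by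
    rw [hd x, ← Real.enorm_of_nonneg hε.le, ← enorm_smul]
    simp only [enorm_le_iff_norm_le]
    rw [ContinuousLinearMap.comp_smul, norm_smul, norm_smul]
    gcongr
    refine (ContinuousLinearMap.opNorm_comp_le _ _).trans ?_
    exact mul_le_of_le_one_right (norm_nonneg _) (norm_rotCLM_le R)
  have hvol := lintegral_image_eq_lintegral_abs_det_fderiv_mul volume hD.measurableSet
    (fun x _ ↦ (hF' x).hasFDerivWithinAt) F.injective.injOn (fun x ↦ ‖fderiv ℝ u x‖ₑ ^ p.toReal)
  have hdet : |(ε • rotCLM R).det| = ε ^ n := by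
    have : (ε • rotCLM R).det = ε ^ n * (rotCLM R).det := by
      simp [ContinuousLinearMap.det, LinearMap.det_smul]
    rw [this, det_rotCLM, mul_one, abs_of_pos (pow_pos hε n)]
  rw [hvol, hdet, lintegral_const_mul' _ _ ENNReal.ofReal_ne_top]
  calc _ ≤ ENNReal.ofReal (ε ^ ((n : ℝ) - p.toReal)) *
        (c * ∫⁻ x in D, ‖fderiv ℝ (u ∘ F) x‖ₑ ^ p.toReal) := by
        gcongr
        exact hc _ (.of_continuous huF.continuous) _ (hasWeakGradientOn_of_contDiff huF)
          (memLp_restrict_of_continuous huF.continuous hDb)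
          (memLp_restrict_of_continuous (huF.continuous_fderiv one_ne_zero) hDb)
    _ ≤ ENNReal.ofReal (ε ^ ((n : ℝ) - p.toReal)) *
        (c * ∫⁻ x in D, ENNReal.ofReal (ε ^ p.toReal) * ‖fderiv ℝ u (F x)‖ₑ ^ p.toReal) := by
        gcongr with x
        rw [← ENNReal.ofReal_rpow_of_pos hε, ← ENNReal.mul_rpow_of_nonneg _ _ ENNReal.toReal_nonneg]
        gcongr
        exact hdn x
    _ = c * (ENNReal.ofReal (ε ^ n) * ∫⁻ x in D, ‖fderiv ℝ u (F x)‖ₑ ^ p.toReal) := by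
        rw [lintegral_const_mul' _ _ ENNReal.ofReal_ne_top]
        have : ε ^ n = ε ^ ((n : ℝ) - p.toReal) * ε ^ p.toReal := by
          rw [← Real.rpow_add hε, sub_add_cancel, Real.rpow_natCast]
        rw [this, ENNReal.ofReal_mul (by positivity)]
        ring

theorem isOpen_of_mem_images (hD : IsOpen D) {D' : Set (E n)}
    (hD' : D' ∈ images (similaritiesOfRatio 𝒢 ε) D Ω) : IsOpen D' := by
  obtain ⟨-, F, -, rfl⟩ := hD'
  exact (AffineEquiv.toContinuousAffineEquiv F).toHomeomorph.isOpenMap D hD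

/-- `c` bounds the packings by the `p`-Dirichlet integral. -/
def IsGradientBound (p : ℝ≥0∞) (D : Set (E n)) (𝒢 : Subgroup (SO n))
    (α : (E n → E m) → Set (E n) → ℝ≥0) (c : ℝ≥0) : Prop :=
  ∀ ε : ℝ, 0 < ε → ∀ Ω : Set (E n), ∀ s, IsPacking D 𝒢 ε Ω s → ∀ u : E n → E m, ContDiff ℝ 1 u →
    ENNReal.ofReal (ε ^ ((n : ℝ) - p.toReal)) * ∑ D' ∈ s, (α u D' : ℝ≥0∞) ≤
      c * ∫⁻ x in Ω, ‖fderiv ℝ u x‖ₑ ^ p.toReal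

theorem exists_isGradientBound (hD : IsOpen D) (hDb : Bornology.IsBounded D)
    (hα : IsCoreFunctional p D (similarities 𝒢) α) :
    ∃ c : ℝ≥0, IsGradientBound p D 𝒢 α c := by
  obtain ⟨c, hc⟩ := exists_alpha_le_lintegral hD hDb hα
  refine ⟨c, fun ε hε Ω s hs u hu ↦ ?_⟩
  rw [Finset.mul_sum]
  calc _ ≤ ∑ D' ∈ s, c * ∫⁻ x in D', ‖fderiv ℝ u x‖ₑ ^ p.toReal := by
        refine Finset.sum_le_sum fun D' hD' ↦ ?_
        exact hc ε hε D' (images_mono (subset_univ _) (hs.1 D' hD')) u hu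
    _ = c * ∫⁻ x in ⋃ D' ∈ s, D', ‖fderiv ℝ u x‖ₑ ^ p.toReal := by
        rw [← Finset.mul_sum]
        congr 1
        exact (lintegral_biUnion_finset (t := id) hs.2
          (fun D' hD' ↦ (isOpen_of_mem_images hD (hs.1 D' hD')).measurableSet) _).symm
    _ ≤ _ := by
        gcongr
        exact iUnion₂_subset fun D' hD' ↦ (hs.1 D' hD').1

theorem IsGradientBound.G_le {c : ℝ≥0} (hc : IsGradientBound p D 𝒢 α c) (hε : 0 < ε)
    (hu : ContDiff ℝ 1 u) :
    G p D 𝒢 α ε u Ω ≤ c * ∫⁻ x in Ω, ‖fderiv ℝ u x‖ₑ ^ p.toReal :=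
  BMOType.G_le fun s hs ↦ hc ε hε Ω s hs u hu

/-! ### A convergence criterion -/

theorem exists_mul_add_lt {x : ℝ≥0} {y : ℝ≥0∞} (h : x < y) :
    ∃ t : ℝ≥0, 0 < t ∧ ((1 + t : ℝ≥0) : ℝ≥0∞) * x + t < y := by
  have hc : Tendsto (fun t : ℝ≥0 ↦ (((1 + t) * x + t : ℝ≥0) : ℝ≥0∞)) (𝓝[>] 0) (𝓝 x) := by
    rw [ENNReal.tendsto_coe]
    have : Continuous fun t : ℝ≥0 ↦ (1 + t) * x + t := by fun_prop
    simpa using (this.tendsto 0).mono_left (nhdsWithin_le_nhds (s := Ioi 0))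
  obtain ⟨t, ht, ht0⟩ := (((tendsto_order.1 hc).2 y h).and eventually_mem_nhdsWithin).exists
  exact ⟨t, ht0, by simpa using ht⟩

/-- Tailored to the quasi-triangle inequality, which compares two quantities only up to a factor `a
> 1` and an additive error. -/
theorem tendsto_of_eventually_le_mul_add {ι : Type*} {l : Filter ι} {f : ι → ℝ≥0∞} {L : ℝ≥0∞}
    (hL : L ≠ ∞)
    (h₁ : ∀ a : ℝ≥0, 1 < a → ∀ θ : ℝ≥0, 0 < θ → ∀ᶠ i in l, f i ≤ a * L + θ)
    (h₂ : ∀ a : ℝ≥0, 1 < a → ∀ θ : ℝ≥0, 0 < θ → ∀ᶠ i in l, L ≤ a * f i + θ) :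
    Tendsto f l (𝓝 L) := by
  lift L to ℝ≥0 using hL
  refine tendsto_order.2 ⟨fun x hx ↦ ?_, fun x hx ↦ ?_⟩
  · lift x to ℝ≥0 using hx.ne_top
    obtain ⟨t, ht0, ht⟩ := exists_mul_add_lt hx
    filter_upwards [h₂ (1 + t) (by simpa using ht0) t ht0] with i hi
    by_contra! hcon
    exact (hi.trans (by gcongr)).not_gt ht
  · obtain ⟨t, ht0, ht⟩ := exists_mul_add_lt hx
    filter_upwards [h₁ (1 + t) (by simpa using ht0) t ht0] with i hi
    exact hi.trans_lt ht

theorem le_of_forall_le_mul_add {x L : ℝ≥0∞} (h : ∀ a : ℝ≥0, 1 < a → x ≤ a * L) : x ≤ L := by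
  refine le_of_forall_gt_imp_ge_of_dense fun y hy ↦ ?_
  lift L to ℝ≥0 using hy.ne_top
  obtain ⟨t, ht0, ht⟩ := exists_mul_add_lt hy
  exact (h (1 + t) (by simpa using ht0)).trans (le_self_add.trans ht.le)

/-! ### Cubes -/

/-- The open cube of centre `x` and side `r`. -/
def cube (x : E n) (r : ℝ) : Set (E n) := {y | ∀ i, |y i - x i| < r / 2}

theorem image_homothety_Q {r : ℝ} (hr : 0 < r) (x : E n) :
    homothety r hr.ne' x '' Q n = cube x r := by
  ext y
  simp only [mem_image, Q, cube, mem_ofPred_eq, mem_Ioo]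
  constructor
  · rintro ⟨z, hz, rfl⟩ i
    simp only [homothety_apply, PiLp.add_apply, PiLp.smul_apply, smul_eq_mul, add_sub_cancel_right,
      abs_mul, abs_of_pos hr]
    have : |z i| < 1 / 2 := abs_lt.2 (hz i)
    nlinarith
  · intro h
    refine ⟨r⁻¹ • (y - x), fun i ↦ ?_, by simp [smul_smul, mul_inv_cancel₀ hr.ne']⟩
    rw [← mem_Ioo, mem_Ioo, ← abs_lt]
    simp only [PiLp.smul_apply, PiLp.sub_apply, smul_eq_mul, abs_mul, abs_of_pos (inv_pos.2 hr)]
    rw [inv_mul_lt_iff₀ hr]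
    linarith [h i]

theorem cube_eq_preimage {r : ℝ} (hr : 0 < r) (x : E n) :
    cube x r = WithLp.ofLp ⁻¹' Metric.ball (WithLp.ofLp x) (r / 2) := by
  ext y
  simp [cube, dist_pi_lt_iff (half_pos hr), Real.dist_eq]

theorem isOpen_cube (x : E n) (r : ℝ) : IsOpen (cube x r) := by
  simp only [cube, ofPred_forall]
  exact isOpen_iInter_of_finite fun i ↦ isOpen_lt (by fun_prop) continuous_const

theorem volume_cube {r : ℝ} (hr : 0 < r) (x : E n) :
    volume (cube x r) = ENNReal.ofReal (r ^ n) := by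
  rw [cube_eq_preimage hr, (PiLp.volume_preserving_ofLp (Fin n)).measure_preimage
    Metric.isOpen_ball.measurableSet.nullMeasurableSet, Real.volume_pi_ball _ (half_pos hr)]
  simp [mul_div_cancel₀]

theorem Q_eq_cube : Q n = cube 0 1 := by
  rw [← image_homothety_Q one_pos]
  simp

theorem volume_Q : volume (Q n) = 1 := by
  rw [Q_eq_cube, volume_cube one_pos]; simp

theorem exists_grid_of_cubes {k : ℕ} (hk : 0 < k) {r : ℝ} (hrk : r * k ≤ 1) :
    ∃ x : (Fin n → Fin k) → E n, (∀ j, cube (x j) r ⊆ Q n) ∧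
      Pairwise fun i j ↦ Disjoint (cube (x i) r) (cube (x j) r) := by
  have hk' : (0 : ℝ) < k := by exact_mod_cast hk
  have hr' : r ≤ 1 / k := by rwa [le_div_iff₀ hk']
  -- Midpoints of the cells of the regular grid of mesh `1/k`; the side `r ≤ 1/k` fits in a cell.
  refine ⟨fun j ↦ WithLp.toLp 2 fun i ↦ -(1 / 2) + ((j i : ℝ) + 1 / 2) * (1 / k), ?_, ?_⟩
  · intro j y hy i
    have h := abs_lt.1 (hy i)
    simp only at h
    have h1 : (0 : ℝ) ≤ (j i : ℝ) * (1 / k) := by positivity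
    have h2 : ((j i : ℝ) + 1) * (1 / k) ≤ 1 := by
      rw [mul_one_div, div_le_one hk']
      exact_mod_cast (j i).2
    constructor <;> linarith [h.1, h.2]
  · intro j l hjl
    obtain ⟨i, hi⟩ := Function.ne_iff.1 hjl
    refine Set.disjoint_left.2 fun y hy hy' ↦ hi ?_
    have h := abs_lt.1 (hy i)
    have h' := abs_lt.1 (hy' i)
    simp only at h h'
    have h1 : ((j i : ℝ) - l i) * (1 / k) < 1 / k := by linarith [h.1, h'.2]
    have h2 : ((l i : ℝ) - j i) * (1 / k) < 1 / k := by linarith [h.2, h'.1]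
    rw [mul_one_div, div_lt_div_iff_of_pos_right hk'] at h1 h2
    have h3 : (j i : ℝ) < l i + 1 := by linarith
    have h4 : (l i : ℝ) < j i + 1 := by linarith
    norm_cast at h3 h4
    omega

/-! ### The integrand -/

/-- `Q` contains `k^n` disjoint cubes of side `ε/δ`, where `k = ⌊δ/ε⌋`. Each is a scaled copy of the
problem at scale `δ` and contributes `(ε/δ)^n` times its value. -/
theorem exists_G_linear_scaling (hp : 1 ≤ p) (hp' : p ≠ ∞)
    (hα : IsCoreFunctional p D (similarities 𝒢) α) (A : E n →L[ℝ] E m) {δ : ℝ} (hδ : 0 < δ)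
    (hε : 0 < ε) (hεδ : ε ≤ δ) :
    ENNReal.ofReal ((⌊δ / ε⌋₊ / (δ / ε)) ^ n) * G p D 𝒢 α δ (fun x ↦ A x) (Q n) ≤
      G p D 𝒢 α ε (fun x ↦ A x) (Q n) := by
  set k := ⌊δ / ε⌋₊
  have hk : 0 < k := Nat.floor_pos.2 (by rwa [le_div_iff₀ hε, one_mul])
  have hr : 0 < ε / δ := div_pos hε hδ
  have hrk : ε / δ * k ≤ 1 := by
    have : (k : ℝ) ≤ δ / ε := Nat.floor_le (by positivity)
    calc ε / δ * k ≤ ε / δ * (δ / ε) := by gcongr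
      _ = 1 := by field_simp
  obtain ⟨x, hx, hd⟩ := exists_grid_of_cubes (n := n) hk hrk
  refine le_trans (le_of_eq ?_) (sum_G_le_of_disjoint hp hp' hα hε (.of_continuous A.continuous)
    Finset.univ (fun j ↦ cube (x j) (ε / δ)) (fun j _ ↦ hx j) (fun i _ j _ hij ↦ hd hij))
  have : ∀ j, G p D 𝒢 α ε (fun x ↦ A x) (cube (x j) (ε / δ)) =
      ENNReal.ofReal ((ε / δ) ^ n) * G p D 𝒢 α δ (fun x ↦ A x) (Q n) := by
    intro j
    rw [← image_homothety_Q hr, ← G_linear_homothety hα hδ A hr, div_mul_cancel₀ _ hδ.ne']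
  simp only [this, Finset.sum_const, Finset.card_univ, Fintype.card_pi, Fintype.card_fin,
    Finset.prod_const, nsmul_eq_mul, ← mul_assoc]
  congr 1
  rw [← ENNReal.ofReal_natCast, ← ENNReal.ofReal_mul (by positivity), Nat.cast_pow, ← mul_pow]
  congr 2
  field_simp

/-- The prefactor in `exists_G_linear_scaling` tends to 1 as `ε → 0`, so the lower limit dominates
the value at every fixed `δ`. -/
theorem tendsto_G_linear_iSup (hp : 1 ≤ p) (hp' : p ≠ ∞)
    (hα : IsCoreFunctional p D (similarities 𝒢) α) (A : E n →L[ℝ] E m) :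
    Tendsto (fun ε ↦ G p D 𝒢 α ε (fun x ↦ A x) (Q n)) (𝓝[>] (0 : ℝ))
      (𝓝 (⨆ (ε : ℝ) (_ : 0 < ε), G p D 𝒢 α ε (fun x ↦ A x) (Q n))) := by
  refine tendsto_order.2 ⟨fun y hy ↦ ?_, fun y hy ↦ ?_⟩
  · simp only [lt_iSup_iff] at hy
    obtain ⟨δ, hδ, hy⟩ := hy
    have h1 : Tendsto (fun ε : ℝ ↦ δ / ε) (𝓝[>] 0) atTop :=
      (tendsto_inv_nhdsGT_zero.const_mul_atTop hδ)
    have h2 : Tendsto (fun ε : ℝ ↦ ENNReal.ofReal ((⌊δ / ε⌋₊ / (δ / ε)) ^ n) *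
        G p D 𝒢 α δ (fun x ↦ A x) (Q n)) (𝓝[>] 0) (𝓝 (G p D 𝒢 α δ (fun x ↦ A x) (Q n))) := by
      have h3 := ENNReal.tendsto_ofReal (((tendsto_nat_floor_div_atTop (R := ℝ)).comp h1).pow n)
      have := ENNReal.Tendsto.mul_const (b := G p D 𝒢 α δ (fun x ↦ A x) (Q n)) h3 (by simp)
      simpa using this
    filter_upwards [(tendsto_order.1 h2).1 y hy, Ioc_mem_nhdsGT hδ] with ε h hε
    exact h.trans_le (exists_G_linear_scaling hp hp' hα A hδ hε.1 hε.2)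
  · filter_upwards [self_mem_nhdsWithin] with ε hε
    exact (le_iSup₂_of_le ε hε le_rfl).trans_lt hy

theorem psi_eq_iSup (hp : 1 ≤ p) (hp' : p ≠ ∞)
    (hα : IsCoreFunctional p D (similarities 𝒢) α) (A : E n →L[ℝ] E m) :
    psi p D 𝒢 α A = ⨆ (ε : ℝ) (_ : 0 < ε), G p D 𝒢 α ε (fun x ↦ A x) (Q n) :=
  (tendsto_G_linear_iSup hp hp' hα A).limUnder_eq

theorem tendsto_psi (hp : 1 ≤ p) (hp' : p ≠ ∞)
    (hα : IsCoreFunctional p D (similarities 𝒢) α) (A : E n →L[ℝ] E m) :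
    Tendsto (fun ε ↦ G p D 𝒢 α ε (fun x ↦ A x) (Q n)) (𝓝[>] (0 : ℝ)) (𝓝 (psi p D 𝒢 α A)) :=
  psi_eq_iSup hp hp' hα A ▸ tendsto_G_linear_iSup hp hp' hα A

theorem G_linear_cube (hα : IsCoreFunctional p D (similarities 𝒢) α) (hε : 0 < ε)
    (A : E n →L[ℝ] E m) {r : ℝ} (hr : 0 < r) (x : E n) :
    G p D 𝒢 α ε (fun x ↦ A x) (cube x r) =
      volume (cube x r) * G p D 𝒢 α (ε / r) (fun x ↦ A x) (Q n) := by
  rw [volume_cube hr, ← image_homothety_Q hr, ← G_linear_homothety hα (div_pos hε hr) A hr,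
    mul_div_cancel₀ _ hr.ne']

theorem G_linear_cube_le (hp : 1 ≤ p) (hp' : p ≠ ∞)
    (hα : IsCoreFunctional p D (similarities 𝒢) α) (hε : 0 < ε)
    (A : E n →L[ℝ] E m) {r : ℝ} (hr : 0 < r) (x : E n) :
    G p D 𝒢 α ε (fun x ↦ A x) (cube x r) ≤ volume (cube x r) * psi p D 𝒢 α A := by
  rw [G_linear_cube hα hε A hr, psi_eq_iSup hp hp' hα]
  gcongr
  exact le_iSup₂_of_le (ε / r) (div_pos hε hr) le_rfl

theorem tendsto_G_linear_cube (hp : 1 ≤ p) (hp' : p ≠ ∞)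
    (hα : IsCoreFunctional p D (similarities 𝒢) α)
    (A : E n →L[ℝ] E m) {r : ℝ} (hr : 0 < r) (x : E n) :
    Tendsto (fun ε ↦ G p D 𝒢 α ε (fun x ↦ A x) (cube x r)) (𝓝[>] (0 : ℝ))
      (𝓝 (volume (cube x r) * psi p D 𝒢 α A)) := by
  have h1 : Tendsto (fun ε : ℝ ↦ ε / r) (𝓝[>] 0) (𝓝[>] 0) := by
    refine tendsto_nhdsWithin_iff.2 ⟨?_, ?_⟩
    · have : Continuous fun ε : ℝ ↦ ε / r := by fun_prop
      simpa using (this.tendsto 0).mono_left (nhdsWithin_le_nhds (s := Ioi 0))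
    · filter_upwards [self_mem_nhdsWithin] with ε hε using div_pos hε hr
  have h2 := ENNReal.Tendsto.const_mul (a := volume (cube x r))
    ((tendsto_psi hp hp' hα A).comp h1) (.inr (by simp [volume_cube hr]))
  refine h2.congr' ?_
  filter_upwards [self_mem_nhdsWithin] with ε hε
  rw [G_linear_cube hα hε A hr]
  rfl

theorem IsGradientBound.psi_le {c : ℝ≥0} (hc : IsGradientBound p D 𝒢 α c) (hp : 1 ≤ p)
    (hp' : p ≠ ∞) (hα : IsCoreFunctional p D (similarities 𝒢) α) (A : E n →L[ℝ] E m) :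
    psi p D 𝒢 α A ≤ c * ‖A‖ₑ ^ p.toReal := by
  rw [psi_eq_iSup hp hp' hα]
  refine iSup₂_le fun ε hε ↦ (hc.G_le hε A.contDiff).trans ?_
  simp [volume_Q]

theorem psi_smul (hp : 1 ≤ p) (hp' : p ≠ ∞) (hα : IsCoreFunctional p D (similarities 𝒢) α)
    (t : ℝ) (A : E n →L[ℝ] E m) :
    psi p D 𝒢 α (t • A) = ‖t‖ₑ ^ p.toReal * psi p D 𝒢 α A := by
  simp only [psi_eq_iSup hp hp' hα, ENNReal.mul_iSup]
  congr! 4 with ε hε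
  exact G_smul hα hε (.of_continuous A.continuous) t

/-- The inequality `G(u + v) ≤ a G(u) + b G(v)`. -/
def IsQuasiTriangle (p : ℝ≥0∞) (D : Set (E n)) (𝒢 : Subgroup (SO n))
    (α : (E n → E m) → Set (E n) → ℝ≥0) (a b : ℝ≥0) : Prop :=
  ∀ ε : ℝ, 0 < ε → ∀ (Ω : Set (E n)) (u v : E n → E m), MemLpLoc p u → MemLpLoc p v →
    G p D 𝒢 α ε (u + v) Ω ≤ a * G p D 𝒢 α ε u Ω + b * G p D 𝒢 α ε v Ω

theorem IsQuasiTriangle.psi_add_le {a b : ℝ≥0} (h : IsQuasiTriangle p D 𝒢 α a b) (hp : 1 ≤ p)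
    (hp' : p ≠ ∞) (hα : IsCoreFunctional p D (similarities 𝒢) α) (A B : E n →L[ℝ] E m) :
    psi p D 𝒢 α (A + B) ≤ a * psi p D 𝒢 α A + b * psi p D 𝒢 α B := by
  simp only [psi_eq_iSup hp hp' hα]
  refine iSup₂_le fun ε hε ↦ (h ε hε (Q n) (fun x ↦ A x) (fun x ↦ B x)
    (.of_continuous A.continuous) (.of_continuous B.continuous)).trans ?_
  gcongr <;> exact le_iSup₂_of_le ε hε le_rfl

theorem IsQuasiTriangle.psi_le {a b : ℝ≥0} (h : IsQuasiTriangle p D 𝒢 α a b) (hp : 1 ≤ p)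
    (hp' : p ≠ ∞) (hα : IsCoreFunctional p D (similarities 𝒢) α) {c : ℝ≥0}
    (hc : IsGradientBound p D 𝒢 α c) (A B : E n →L[ℝ] E m) :
    psi p D 𝒢 α A ≤ a * psi p D 𝒢 α B + b * (c * ‖A - B‖ₑ ^ p.toReal) := by
  have := h.psi_add_le hp hp' hα B (A - B)
  rw [add_sub_cancel] at this
  refine this.trans ?_
  gcongr
  exact hc.psi_le hp hp' hα _

/-- `ψ(A)` and `ψ(B)` bound each other up to a factor `a` close to 1 and an error `b c |A - B|^p`.
-/
theorem continuous_psi (hp : 1 ≤ p) (hp' : p ≠ ∞)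
    (hα : IsCoreFunctional p D (similarities 𝒢) α) {c : ℝ≥0} (hc : IsGradientBound p D 𝒢 α c) :
    Continuous (psi p D 𝒢 α) := by
  have hp0 : 0 < p.toReal := ENNReal.toReal_pos (one_pos.trans_le hp).ne' hp'
  refine continuous_iff_continuousAt.2 fun A ↦ tendsto_of_eventually_le_mul_add
    (ne_top_of_le_ne_top (by finiteness) (hc.psi_le hp hp' hα A)) ?_ ?_
  all_goals
    intro a ha θ hθ
    obtain ⟨b, hb⟩ := exists_G_add_le hα ha
    have hcont : Continuous fun B : E n →L[ℝ] E m ↦ (b * (c * ‖B - A‖₊ ^ p.toReal) : ℝ≥0) := by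
      fun_prop (disch := positivity)
    have hlt := (tendsto_order.1 (hcont.tendsto A)).2 θ
      (by simpa [NNReal.zero_rpow hp0.ne'] using hθ)
    filter_upwards [hlt] with B hB
  · refine (IsQuasiTriangle.psi_le hb hp hp' hα hc B A).trans ?_
    gcongr
    rw [enorm_eq_nnnorm, ← ENNReal.coe_rpow_of_nonneg _ hp0.le]
    exact_mod_cast hB.le
  · refine (IsQuasiTriangle.psi_le hb hp hp' hα hc A B).trans ?_
    gcongr
    rw [enorm_sub_rev, enorm_eq_nnnorm, ← ENNReal.coe_rpow_of_nonneg _ hp0.le]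
    exact_mod_cast hB.le

/-- The null set of `ψ`. -/
def nullSubmodule (hp : 1 ≤ p) (hp' : p ≠ ∞) (hα : IsCoreFunctional p D (similarities 𝒢) α) :
    Submodule ℝ (E n →L[ℝ] E m) where
  carrier := {A | psi p D 𝒢 α A = 0}
  zero_mem' := by
    have hp0 : 0 < p.toReal := ENNReal.toReal_pos (one_pos.trans_le hp).ne' hp'
    have := psi_smul hp hp' hα 0 (0 : E n →L[ℝ] E m)
    have h0 : (0 : ℝ) • (0 : E n →L[ℝ] E m) = 0 := by ext; simp
    rwa [h0, enorm_zero, ENNReal.zero_rpow_of_pos hp0, zero_mul] at this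
  add_mem' {A B} hA hB := by
    obtain ⟨b, hb⟩ := exists_G_add_le hα (a := 2) one_lt_two
    have := IsQuasiTriangle.psi_add_le hb hp hp' hα A B
    rw [mem_ofPred_eq] at hA hB
    simpa [hA, hB] using this
  smul_mem' t A hA := by
    rw [mem_ofPred_eq] at hA ⊢
    rw [psi_smul hp hp' hα, hA, mul_zero]

/-- On the unit sphere of `P` the continuous function `ψ` does not vanish, so compactness gives a
positive minimum, and homogeneity extends the bound to `P`. Since `A` and its projection differ by a
null element, the quasi-triangle inequality with `a → 1` passes from the projection to `A`. -/
theorem exists_mul_enorm_projection_le (hp : 1 ≤ p) (hp' : p ≠ ∞)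
    (hα : IsCoreFunctional p D (similarities 𝒢) α) {c : ℝ≥0} (hc : IsGradientBound p D 𝒢 α c)
    (P : Submodule ℝ (E n →L[ℝ] E m)) (hP : IsCompl P (nullSubmodule hp hp' hα)) :
    ∃ C : ℝ≥0, 0 < C ∧ ∀ A, C * ‖P.projection (nullSubmodule hp hp' hα) hP A‖ₑ ^ p.toReal ≤
      psi p D 𝒢 α A := by
  have hp0 : 0 < p.toReal := ENNReal.toReal_pos (one_pos.trans_le hp).ne' hp'
  have hK : IsCompact (Metric.sphere (0 : E n →L[ℝ] E m) 1 ∩ P) :=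
    (isCompact_sphere 0 1).inter_right P.closed_of_finiteDimensional
  obtain ⟨C, hC0, hC⟩ : ∃ C : ℝ≥0, 0 < C ∧
      ∀ A ∈ Metric.sphere (0 : E n →L[ℝ] E m) 1 ∩ P, C ≤ psi p D 𝒢 α A := by
    rcases (Metric.sphere (0 : E n →L[ℝ] E m) 1 ∩ P).eq_empty_or_nonempty with h | h
    -- `P` has no unit vector, so any positive constant serves.
    · exact ⟨1, one_pos, by simp [h]⟩
    · obtain ⟨A, hA, hmin⟩ := hK.exists_isMinOn h (continuous_psi hp hp' hα hc).continuousOn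
      have hfin : psi p D 𝒢 α A ≠ ∞ :=
        ne_top_of_le_ne_top (by finiteness) (hc.psi_le hp hp' hα A)
      refine ⟨(psi p D 𝒢 α A).toNNReal, ?_, fun B hB ↦ ?_⟩
      · refine ENNReal.toNNReal_pos (fun h0 ↦ ?_) hfin
        have : A = 0 := Submodule.disjoint_def.1 hP.disjoint A hA.2 h0
        simp [this] at hA
      · rw [ENNReal.coe_toNNReal hfin]
        exact hmin hB
  refine ⟨C, hC0, fun A ↦ ?_⟩
  set B := P.projection (nullSubmodule hp hp' hα) hP A with hB
  have hBP : B ∈ P := by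
    rw [hB]; exact Submodule.projection_apply_mem hP A
  have hAB : psi p D 𝒢 α (B - A) = 0 := by
    rw [← neg_sub, ← neg_one_smul ℝ, psi_smul hp hp' hα]
    have : psi p D 𝒢 α (A - B) = 0 := Submodule.sub_projection_mem hP A
    rw [this, mul_zero]
  have h1 : psi p D 𝒢 α B ≤ psi p D 𝒢 α A := by
    refine le_of_forall_le_mul_add fun a ha ↦ ?_
    obtain ⟨b, hb⟩ := exists_G_add_le hα ha
    have := IsQuasiTriangle.psi_add_le hb hp hp' hα A (B - A)
    simpa [hAB] using this
  refine le_trans ?_ h1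
  rcases eq_or_ne ‖B‖ 0 with h0 | hn
  · have h2 : ‖B‖ₑ = 0 := by rw [← ofReal_norm, h0, ENNReal.ofReal_zero]
    rw [h2, ENNReal.zero_rpow_of_pos hp0, mul_zero]
    exact zero_le
  · have h2 := hC (‖B‖⁻¹ • B) ⟨by simp [norm_smul, inv_mul_cancel₀ hn], P.smul_mem _ hBP⟩
    have h3 : B = ‖B‖ • (‖B‖⁻¹ • B) := by rw [smul_smul, mul_inv_cancel₀ hn, one_smul]
    conv_rhs => rw [h3, psi_smul hp hp' hα, enorm_norm]
    rw [mul_comm]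
    gcongr

/-! ### Filling an open set with finitely many small cubes -/

theorem mem_cube_self {r : ℝ} (hr : 0 < r) (x : E n) : x ∈ cube x r := fun i ↦ by
  simpa using hr

theorem cube_mono {r r' : ℝ} (h : r ≤ r') (x : E n) : cube x r ⊆ cube x r' :=
  fun _ hy i ↦ (hy i).trans_le (by linarith)

theorem exists_cube_subset_ball {δ : ℝ} (hδ : 0 < δ) :
    ∃ ρ > 0, ∀ r < ρ, ∀ x : E n, ∀ y ∈ cube x r, dist y x < δ := by
  obtain ⟨ρ, hρ, h⟩ := Metric.uniformContinuous_iff.1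
    (PiLp.uniformContinuous_toLp 2 (fun _ : Fin n ↦ ℝ)) δ hδ
  refine ⟨ρ, hρ, fun r hr x y hy ↦ @h y.ofLp x.ofLp ?_⟩
  rw [dist_pi_lt_iff hρ]
  intro i
  have h1 := hy i
  rw [Real.dist_eq]
  have := abs_nonneg (y i - x i)
  linarith

/-- A finite family of disjoint open cubes in `Ω` such that the concentric cubes with sides scaled
by `δ` fill `Ω` up to measure `η`. -/
structure CubeFilling (Ω : Set (E n)) (ρ δ : ℝ) (η : ℝ≥0∞) (ι : Type) [Fintype ι] where
  center : ι → E n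
  side : ι → ℝ
  side_pos : ∀ i, 0 < side i
  side_lt : ∀ i, side i < ρ
  subset : ∀ i, cube (center i) (side i) ⊆ Ω
  disjoint : Pairwise fun i j ↦ Disjoint (cube (center i) (side i)) (cube (center j) (side j))
  volume_le : volume (Ω \ ⋃ i, cube (center i) (δ * side i)) ≤ η

/-- Balls of the sup norm on `Fin n → ℝ` are cubes, so the Besicovitch theorem covers `Ω` up to a
null set by disjoint small closed cubes inside it. Finitely many of them, even slightly shrunk,
already miss at most measure `η`. -/
theorem exists_cubeFilling (hΩ : IsOpen Ω) (hfin : volume Ω ≠ ∞) {ρ : ℝ} (hρ : 0 < ρ)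
    {η : ℝ≥0∞} (hη : η ≠ 0) :
    ∃ (ι : Type) (_ : Fintype ι) (δ : ℝ), 0 < δ ∧ δ < 1 ∧ Nonempty (CubeFilling Ω ρ δ η ι) := by
  rcases eq_or_ne (volume Ω) 0 with h0 | h0
  · exact ⟨Empty, inferInstance, 1 / 2, by norm_num, by norm_num,
      ⟨⟨Empty.elim, Empty.elim, nofun, nofun, nofun, nofun, by simp [h0]⟩⟩⟩
  set Ω₀ : Set (Fin n → ℝ) := WithLp.toLp 2 ⁻¹' Ω
  have hΩ₀ : IsOpen Ω₀ := hΩ.preimage (PiLp.continuous_toLp 2 _)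
  have hvol : volume Ω₀ = volume Ω :=
    (PiLp.volume_preserving_toLp (Fin n)).measure_preimage hΩ.measurableSet.nullMeasurableSet
  obtain ⟨t, r, htc, -, hr, hcov, hdisj⟩ := Besicovitch.exists_disjoint_closedBall_covering_ae
    volume (fun x ↦ {r | Metric.closedBall x r ⊆ Ω₀}) Ω₀ (fun x hx δ hδ ↦ by
      obtain ⟨e, he, hs⟩ := Metric.isOpen_iff.1 hΩ₀ x hx
      refine ⟨min e δ / 2, ?_, by positivity, ?_⟩
      · exact (Metric.closedBall_subset_ball
          (by have := min_le_left e δ; have : 0 < min e δ := by positivity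
              linarith)).trans hs
      · have := min_le_right e δ; have : 0 < min e δ := by positivity
        linarith) (fun _ ↦ ρ / 2) (fun _ _ ↦ half_pos hρ)
  have hrpos : ∀ x : t, 0 < r x := fun x ↦ (hr x x.2).2.1
  have hcube : ∀ x : t, ∀ s > 0, volume (cube (WithLp.toLp 2 x.1 : E n) (s * (2 * r x))) =
      ENNReal.ofReal (s ^ n) * ENNReal.ofReal ((2 * r x) ^ n) := fun x s hs ↦ by
    have := hrpos x
    rw [volume_cube (by positivity), mul_pow, ENNReal.ofReal_mul (by positivity)]
  have hle : volume Ω ≤ ∑' x : t, ENNReal.ofReal ((2 * r x) ^ n) := by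
    calc volume Ω = volume Ω₀ := hvol.symm
      _ ≤ volume (⋃ x ∈ t, Metric.closedBall x (r x)) := by
        rw [← measure_sdiff_add_inter Ω₀
          (MeasurableSet.biUnion htc fun x _ ↦ Metric.isClosed_closedBall.measurableSet), hcov,
          zero_add]
        exact measure_mono inter_subset_right
      _ ≤ ∑' x : t, volume (Metric.closedBall x.1 (r x)) := measure_biUnion_le _ htc _
      _ = _ := by
        congr 1 with x
        rw [Real.volume_pi_closedBall _ (hrpos x).le, Fintype.card_fin]
  -- The strict inequality leaves room for two losses: passing to a finite subfamily, then shrinking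
  -- by `δ < 1`.
  have hlt : volume Ω - η < ∑' x : t, ENNReal.ofReal ((2 * r x) ^ n) :=
    (ENNReal.sub_lt_self hfin h0 hη).trans_le hle
  rw [ENNReal.tsum_eq_iSup_sum, lt_iSup_iff] at hlt
  obtain ⟨s, hs⟩ := hlt
  obtain ⟨δ, hδ, hδ0, hδ1⟩ : ∃ δ : ℝ, volume Ω - η <
      ENNReal.ofReal (δ ^ n) * ∑ x ∈ s, ENNReal.ofReal ((2 * r x) ^ n) ∧ 0 < δ ∧ δ < 1 := by
    have h1 : Tendsto (fun δ : ℝ ↦ ENNReal.ofReal (δ ^ n) *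
        ∑ x ∈ s, ENNReal.ofReal ((2 * r x) ^ n)) (𝓝[<] 1)
        (𝓝 (∑ x ∈ s, ENNReal.ofReal ((2 * r x) ^ n))) := by
      have h2 : Tendsto (fun δ : ℝ ↦ ENNReal.ofReal (δ ^ n)) (𝓝 1) (𝓝 (ENNReal.ofReal (1 ^ n))) :=
        ENNReal.tendsto_ofReal (tendsto_id.pow n)
      have := ENNReal.Tendsto.mul_const (b := ∑ x ∈ s, ENNReal.ofReal ((2 * r x) ^ n))
        (h2.mono_left (nhdsWithin_le_nhds (s := Iio 1))) (by simp)
      simpa using this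
    have h3 : ∀ᶠ δ : ℝ in 𝓝[<] 1, 0 < δ := nhdsWithin_le_nhds (lt_mem_nhds one_pos)
    exact (((tendsto_order.1 h1).1 _ hs).and (h3.and eventually_mem_nhdsWithin)).exists
  have hsub : ∀ x : t, cube (WithLp.toLp 2 x.1 : E n) (2 * r x) ⊆
      WithLp.ofLp ⁻¹' Metric.closedBall x.1 (r x) := fun x ↦ by
    have := hrpos x
    rw [cube_eq_preimage (by positivity), mul_div_cancel_left₀ _ two_ne_zero]
    exact preimage_mono Metric.ball_subset_closedBall
  have hdc : Pairwise fun i j : s ↦ Disjoint (cube (WithLp.toLp 2 i.1.1 : E n) (2 * r i.1))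
      (cube (WithLp.toLp 2 j.1.1 : E n) (2 * r j.1)) := fun i j hij ↦
    ((hdisj i.1.2 j.1.2 fun h ↦ hij (Subtype.ext (Subtype.ext h))).preimage _).mono
      (hsub i.1) (hsub j.1)
  have hcΩ : ∀ i : s, cube (WithLp.toLp 2 i.1.1 : E n) (2 * r i.1) ⊆ Ω := fun i y hy ↦
    (hr i.1 i.1.2).1 (hsub i.1 hy)
  have hmono : ∀ i : s, cube (WithLp.toLp 2 i.1.1 : E n) (δ * (2 * r i.1)) ⊆
      cube (WithLp.toLp 2 i.1.1 : E n) (2 * r i.1) := fun i ↦ cube_mono (by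
    have := hrpos i.1
    nlinarith) _
  refine ⟨s, inferInstance, δ, hδ0, hδ1, ⟨⟨fun i ↦ WithLp.toLp 2 i.1.1, fun i ↦ 2 * r i.1,
    fun i ↦ mul_pos two_pos (hrpos i.1), fun i ↦ ?_, hcΩ, hdc, ?_⟩⟩⟩
  · have := (hr i.1 i.1.2).2.2
    linarith
  have hmeas : ∀ i : s, MeasurableSet (cube (WithLp.toLp 2 i.1.1 : E n) (δ * (2 * r i.1))) :=
    fun i ↦ (isOpen_cube _ _).measurableSet
  have hUΩ : ⋃ i : s, cube (WithLp.toLp 2 i.1.1 : E n) (δ * (2 * r i.1)) ⊆ Ω :=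
    iUnion_subset fun i ↦ (hmono i).trans (hcΩ i)
  rw [measure_sdiff hUΩ (MeasurableSet.iUnion hmeas).nullMeasurableSet
    (ne_top_of_le_ne_top hfin (measure_mono hUΩ)), measure_iUnion
    (fun i j hij ↦ (hdc hij).mono (hmono i) (hmono j)) hmeas, tsum_fintype]
  have : ∑ i : s, volume (cube (WithLp.toLp 2 i.1.1 : E n) (δ * (2 * r i.1))) =
      ENNReal.ofReal (δ ^ n) * ∑ x ∈ s, ENNReal.ofReal ((2 * r x) ^ n) := by
    rw [Finset.mul_sum, ← Finset.sum_coe_sort s]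
    exact Finset.sum_congr rfl fun i _ ↦ hcube i.1 δ hδ0
  rw [this]
  exact tsub_le_iff_tsub_le.1 hδ.le

theorem CubeFilling.volume_diff_le {ρ δ : ℝ} {η : ℝ≥0∞} {ι : Type} [Fintype ι]
    (c : CubeFilling Ω ρ δ η ι) (hδ : δ < 1) :
    volume (Ω \ ⋃ i, cube (c.center i) (c.side i)) ≤ η := by
  refine (measure_mono (sdiff_subset_sdiff_right (iUnion_mono fun i ↦ cube_mono ?_ _))).trans
    c.volume_le
  have := c.side_pos i
  nlinarith

/-! ### Localisation of packings to the cubes of a filling -/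

theorem exists_dist_le_of_mem_images (hDb : Bornology.IsBounded D) :
    ∃ d : ℝ, 0 < d ∧ ∀ ε : ℝ, 0 < ε → ∀ Ω : Set (E n),
      ∀ D' ∈ images (similaritiesOfRatio 𝒢 ε) D Ω, ∀ y ∈ D', ∀ z ∈ D', dist y z ≤ ε * d := by
  obtain ⟨d, hd⟩ := Metric.isBounded_iff.1 hDb
  refine ⟨max d 1, by positivity, ?_⟩
  rintro ε hε Ω _ ⟨-, F, ⟨R, hR, h, hF⟩, rfl⟩ _ ⟨y, hy, rfl⟩ _ ⟨z, hz, rfl⟩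
  have : rot R y - rot R z = rot R (y - z) := (map_sub (rotCLM R) y z).symm
  rw [hF, hF, dist_add_right, dist_eq_norm, ← smul_sub, this, norm_smul, norm_rot,
    Real.norm_of_nonneg hε.le, ← dist_eq_norm]
  gcongr
  exact (hd hy hz).trans (le_max_left _ _)

/-- Once the diameter of the packing elements is below the gap `(1 - δ) * side / 2`, an element
meeting a shrunken cube lies in the full cube. The others avoid all shrunken cubes, so the gradient
bound on the complement controls them. -/
theorem eventually_G_le_sum_cubes (hDb : Bornology.IsBounded D) {c : ℝ≥0}
    (hc : IsGradientBound p D 𝒢 α c) {ρ δ : ℝ} {η : ℝ≥0∞} {ι : Type} [Fintype ι]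
    (Q : CubeFilling Ω ρ δ η ι) (hδ : δ < 1) (hv : ContDiff ℝ 1 v) :
    ∀ᶠ ε in 𝓝[>] (0 : ℝ), G p D 𝒢 α ε v Ω ≤ ∑ i, G p D 𝒢 α ε v (cube (Q.center i) (Q.side i)) +
      c * ∫⁻ x in Ω \ ⋃ i, cube (Q.center i) (δ * Q.side i), ‖fderiv ℝ v x‖ₑ ^ p.toReal := by
  classical
  obtain ⟨d, hd0, hd⟩ := exists_dist_le_of_mem_images (𝒢 := 𝒢) hDb
  have hsmall : ∀ᶠ ε in 𝓝[>] (0 : ℝ), ∀ i, ε * d < (1 - δ) * Q.side i / 2 := by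
    refine eventually_all.2 fun i ↦ nhdsWithin_le_nhds ?_
    have hc : Continuous fun ε : ℝ ↦ ε * d := by fun_prop
    refine (tendsto_order.1 (hc.tendsto 0)).2 _ ?_
    have := Q.side_pos i
    rw [zero_mul]
    have : 0 < (1 - δ) * Q.side i := mul_pos (by linarith) this
    positivity
  filter_upwards [hsmall, self_mem_nhdsWithin] with ε hε hε0
  have hε0 : 0 < ε := hε0
  refine G_le fun s hs ↦ ?_
  set k := ENNReal.ofReal (ε ^ ((n : ℝ) - p.toReal))
  set C : ι → Set (E n) := fun i ↦ cube (Q.center i) (Q.side i)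
  rw [← Finset.sum_filter_add_sum_filter_not s (fun D' ↦ ∃ i, D' ⊆ C i), mul_add]
  refine add_le_add ?_ (hc ε hε0 _ _ ⟨fun D' hD' ↦ ?_, ?_⟩ v hv)
  -- Elements inside some cube are counted once for each cube containing them; overcounting is
  -- harmless in an upper bound.
  · calc _ ≤ k * ∑ D' ∈ s, ∑ i, if D' ⊆ C i then (α v D' : ℝ≥0∞) else 0 := by
          rw [Finset.sum_filter]
          gcongr with D' hD'
          split_ifs with h
          · obtain ⟨i, hi⟩ := h
            exact (if_pos hi).ge.trans
              (Finset.single_le_sum (f := fun i ↦ if D' ⊆ C i then (α v D' : ℝ≥0∞) else 0)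
                (fun _ _ ↦ zero_le) (Finset.mem_univ i))
          · exact zero_le
      _ = ∑ i, k * ∑ D' ∈ s.filter (· ⊆ C i), (α v D' : ℝ≥0∞) := by
          rw [Finset.sum_comm, Finset.mul_sum]
          simp only [Finset.sum_filter]
      _ ≤ _ := by
          refine Finset.sum_le_sum fun i _ ↦ IsPacking.sum_le_G ⟨fun D' hD' ↦ ?_, ?_⟩
          · rw [Finset.mem_filter] at hD'
            exact ⟨hD'.2, (hs.1 D' hD'.1).2⟩
          · exact (hs.subset (Finset.filter_subset _ _)).2
  · rw [Finset.mem_filter] at hD'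
    refine ⟨fun y hy ↦ ⟨(hs.1 D' hD'.1).1 hy, fun hy' ↦ hD'.2 ?_⟩, (hs.1 D' hD'.1).2⟩
    obtain ⟨i, hi⟩ := mem_iUnion.1 hy'
    refine ⟨i, fun z hz j ↦ ?_⟩
    have h1 := hd ε hε0 Ω D' (hs.1 D' hD'.1) z hz y hy
    have h2 : |z j - y j| ≤ dist z y := by
      rw [dist_eq_norm, ← Real.norm_eq_abs]
      exact PiLp.norm_apply_le (z - y) j
    have h3 := hi j
    have h4 := hε i
    have h5 := abs_sub_le (z j) (y j) (Q.center i j)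
    linarith
  · exact (hs.subset (Finset.filter_subset _ _)).2

/-! ### Comparison with the linear part on a cube -/

theorem IsGradientBound.G_le_of_forall_le {c : ℝ≥0} (hc : IsGradientBound p D 𝒢 α c)
    (hε : 0 < ε) (hu : ContDiff ℝ 1 u) {C : Set (E n)} (hC : MeasurableSet C) {e : ℝ≥0∞}
    (he : ∀ y ∈ C, ‖fderiv ℝ u y‖ₑ ^ p.toReal ≤ e) :
    G p D 𝒢 α ε u C ≤ c * (e * volume C) := by
  refine (hc.G_le hε hu).trans ?_
  gcongr
  calc _ ≤ ∫⁻ _ in C, e := setLIntegral_mono' hC he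
    _ = _ := by simp

theorem IsQuasiTriangle.G_le_linear {a b c : ℝ≥0} (h : IsQuasiTriangle p D 𝒢 α a b)
    (hc : IsGradientBound p D 𝒢 α c) (hε : 0 < ε) (hv : ContDiff ℝ 1 v) (A : E n →L[ℝ] E m)
    {C : Set (E n)} (hC : MeasurableSet C) {e : ℝ≥0∞}
    (he : ∀ y ∈ C, ‖fderiv ℝ v y - A‖ₑ ^ p.toReal ≤ e) :
    G p D 𝒢 α ε v C ≤ a * G p D 𝒢 α ε (fun x ↦ A x) C + b * (c * (e * volume C)) := by
  have hd : ∀ y, fderiv ℝ (v - fun x ↦ A x) y = fderiv ℝ v y - A := fun y ↦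
    ((hv.differentiable one_ne_zero y).hasFDerivAt.sub A.hasFDerivAt).fderiv
  have h1 := h ε hε C (fun x ↦ A x) (v - fun x ↦ A x) (.of_continuous A.continuous)
    (.of_continuous (hv.continuous.sub A.continuous))
  rw [add_sub_cancel] at h1
  refine h1.trans ?_
  gcongr
  exact hc.G_le_of_forall_le hε (hv.sub A.contDiff) hC fun y hy ↦
    le_of_eq_of_le (congrArg (‖·‖ₑ ^ p.toReal) (hd y)) (he y hy)

theorem IsQuasiTriangle.G_linear_le {a b c : ℝ≥0} (h : IsQuasiTriangle p D 𝒢 α a b)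
    (hc : IsGradientBound p D 𝒢 α c) (hε : 0 < ε) (hv : ContDiff ℝ 1 v) (A : E n →L[ℝ] E m)
    {C : Set (E n)} (hC : MeasurableSet C) {e : ℝ≥0∞}
    (he : ∀ y ∈ C, ‖fderiv ℝ v y - A‖ₑ ^ p.toReal ≤ e) :
    G p D 𝒢 α ε (fun x ↦ A x) C ≤ a * G p D 𝒢 α ε v C + b * (c * (e * volume C)) := by
  have hd : ∀ y, fderiv ℝ ((fun x ↦ A x) - v) y = A - fderiv ℝ v y := fun y ↦
    (A.hasFDerivAt.sub (hv.differentiable one_ne_zero y).hasFDerivAt).fderiv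
  have h1 := h ε hε C v ((fun x ↦ A x) - v) (.of_continuous hv.continuous)
    (.of_continuous (A.continuous.sub hv.continuous))
  rw [add_sub_cancel] at h1
  refine h1.trans ?_
  gcongr
  exact hc.G_le_of_forall_le hε (A.contDiff.sub hv) hC fun y hy ↦
    le_of_eq_of_le (congrArg (‖·‖ₑ ^ p.toReal) (hd y)) (by rw [enorm_sub_rev]; exact he y hy)

theorem IsQuasiTriangle.volume_mul_psi_le {a b c : ℝ≥0} (h : IsQuasiTriangle p D 𝒢 α a b)
    (hp : 1 ≤ p) (hp' : p ≠ ∞) (hα : IsCoreFunctional p D (similarities 𝒢) α)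
    (hc : IsGradientBound p D 𝒢 α c) {V : E n → (E n →L[ℝ] E m)} (A : E n →L[ℝ] E m)
    {C : Set (E n)} (hC : MeasurableSet C) {e : ℝ≥0∞}
    (he : ∀ y ∈ C, ‖V y - A‖ₑ ^ p.toReal ≤ e) :
    volume C * psi p D 𝒢 α A ≤
      a * (∫⁻ x in C, psi p D 𝒢 α (V x)) + b * (c * (e * volume C)) := by
  calc volume C * psi p D 𝒢 α A = ∫⁻ _ in C, psi p D 𝒢 α A := by simp [mul_comm]
    _ ≤ ∫⁻ x in C, (a * psi p D 𝒢 α (V x) + b * (c * e)) :=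
        setLIntegral_mono' hC fun y hy ↦ by
          refine (h.psi_le hp hp' hα hc A (V y)).trans ?_
          rw [enorm_sub_rev]
          gcongr
          exact he y hy
    _ = _ := by
        rw [lintegral_add_right _ measurable_const, lintegral_const_mul' _ _ ENNReal.coe_ne_top,
          setLIntegral_const]
        ring

theorem IsQuasiTriangle.lintegral_psi_le {a b c : ℝ≥0} (h : IsQuasiTriangle p D 𝒢 α a b)
    (hp : 1 ≤ p) (hp' : p ≠ ∞) (hα : IsCoreFunctional p D (similarities 𝒢) α)
    (hc : IsGradientBound p D 𝒢 α c) {V : E n → (E n →L[ℝ] E m)} (A : E n →L[ℝ] E m)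
    {C : Set (E n)} (hC : MeasurableSet C) {e : ℝ≥0∞}
    (he : ∀ y ∈ C, ‖V y - A‖ₑ ^ p.toReal ≤ e) :
    ∫⁻ x in C, psi p D 𝒢 α (V x) ≤
      a * (volume C * psi p D 𝒢 α A) + b * (c * (e * volume C)) := by
  calc _ ≤ ∫⁻ x in C, (a * psi p D 𝒢 α A + b * (c * e)) :=
        setLIntegral_mono' hC fun y hy ↦ by
          refine (h.psi_le hp hp' hα hc (V y) A).trans ?_
          gcongr
          exact he y hy
    _ = _ := by
        rw [setLIntegral_const]
        ring

/-! ### The limit for functions of class `C¹` -/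

/-- Uniform continuity of the gradient on the compact closure. The same `e` bounds the missed volume
and the `p`-th power of the oscillation. -/
theorem exists_cubeFilling_gradient (hp : 1 ≤ p) (hp' : p ≠ ∞) (hv : ContDiff ℝ 1 v)
    (hΩ : IsOpen Ω) (hK : IsCompact (closure Ω)) {e : ℝ≥0} (he : 0 < e) :
    ∃ (ι : Type) (_ : Fintype ι) (ρ δ : ℝ) (Q : CubeFilling Ω ρ δ e ι), δ < 1 ∧
      ∀ i, ∀ y ∈ cube (Q.center i) (Q.side i),
        ‖fderiv ℝ v y - fderiv ℝ v (Q.center i)‖ₑ ^ p.toReal ≤ e := by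
  have hp0 : 0 < p.toReal := ENNReal.toReal_pos (one_pos.trans_le hp).ne' hp'
  have hfin : volume Ω ≠ ∞ := ne_top_of_le_ne_top hK.measure_lt_top.ne (measure_mono subset_closure)
  obtain ⟨s, hs⟩ : ∃ s : ℝ≥0, s = e ^ (p.toReal)⁻¹ := ⟨_, rfl⟩
  have hs0 : 0 < s := hs ▸ NNReal.rpow_pos he
  obtain ⟨d, hd0, hd⟩ := Metric.uniformContinuousOn_iff.1
    (hK.uniformContinuousOn_of_continuous (hv.continuous_fderiv one_ne_zero).continuousOn)
    s (by exact_mod_cast hs0)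
  obtain ⟨ρ, hρ0, hρ⟩ := exists_cube_subset_ball (n := n) hd0
  obtain ⟨ι, _, δ, -, hδ1, ⟨Q⟩⟩ := exists_cubeFilling hΩ hfin hρ0 (η := e) (by simpa using he.ne')
  refine ⟨ι, inferInstance, ρ, δ, Q, hδ1, fun i y hy ↦ ?_⟩
  have h1 := hd y (subset_closure (Q.subset i hy)) (Q.center i)
    (subset_closure (Q.subset i (mem_cube_self (Q.side_pos i) _))) (hρ _ (Q.side_lt i) _ y hy)
  have h2 : ‖fderiv ℝ v y - fderiv ℝ v (Q.center i)‖₊ ≤ s := by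
    rw [dist_eq_norm] at h1
    exact_mod_cast h1.le
  calc _ ≤ (s : ℝ≥0∞) ^ p.toReal := by
        gcongr
        rw [enorm_eq_nnnorm]
        exact_mod_cast h2
    _ = e := by
        rw [← ENNReal.coe_rpow_of_nonneg _ hp0.le, hs, NNReal.rpow_inv_rpow hp0.ne']

theorem CubeFilling.measurableSet {ρ δ : ℝ} {η : ℝ≥0∞} {ι : Type} [Fintype ι]
    (Q : CubeFilling Ω ρ δ η ι) (i : ι) : MeasurableSet (cube (Q.center i) (Q.side i)) :=
  (isOpen_cube _ _).measurableSet

theorem CubeFilling.sum_lintegral_eq {ρ δ : ℝ} {η : ℝ≥0∞} {ι : Type} [Fintype ι]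
    (Q : CubeFilling Ω ρ δ η ι) (f : E n → ℝ≥0∞) :
    ∑ i, ∫⁻ x in cube (Q.center i) (Q.side i), f x =
      ∫⁻ x in ⋃ i, cube (Q.center i) (Q.side i), f x := by
  rw [lintegral_iUnion Q.measurableSet Q.disjoint, tsum_fintype]

theorem CubeFilling.sum_lintegral_le {ρ δ : ℝ} {η : ℝ≥0∞} {ι : Type} [Fintype ι]
    (Q : CubeFilling Ω ρ δ η ι) (f : E n → ℝ≥0∞) :
    ∑ i, ∫⁻ x in cube (Q.center i) (Q.side i), f x ≤ ∫⁻ x in Ω, f x := by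
  rw [Q.sum_lintegral_eq]
  exact lintegral_mono_set (iUnion_subset Q.subset)

theorem CubeFilling.sum_volume_le {ρ δ : ℝ} {η : ℝ≥0∞} {ι : Type} [Fintype ι]
    (Q : CubeFilling Ω ρ δ η ι) :
    ∑ i, volume (cube (Q.center i) (Q.side i)) ≤ volume Ω := by
  simpa using Q.sum_lintegral_le 1

theorem CubeFilling.lintegral_le {ρ δ : ℝ} {η : ℝ≥0} {ι : Type} [Fintype ι]
    (Q : CubeFilling Ω ρ δ η ι) (hδ : δ < 1) (hΩ : IsOpen Ω) {f : E n → ℝ≥0∞} {M : ℝ≥0∞}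
    (hf : ∀ x ∈ Ω, f x ≤ M) :
    ∫⁻ x in Ω, f x ≤ ∑ i, (∫⁻ x in cube (Q.center i) (Q.side i), f x) + M * η := by
  have hU : MeasurableSet (⋃ i, cube (Q.center i) (Q.side i)) := .iUnion Q.measurableSet
  rw [Q.sum_lintegral_eq]
  calc _ ≤ ∫⁻ x in (⋃ i, cube (Q.center i) (Q.side i)) ∪
        (Ω \ ⋃ i, cube (Q.center i) (Q.side i)), f x :=
        lintegral_mono_set (by rw [union_sdiff_self]; exact subset_union_right)
    _ ≤ _ := lintegral_union_le _ _ _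
    _ ≤ _ := by
        gcongr
        calc _ ≤ ∫⁻ _ in Ω \ ⋃ i, cube (Q.center i) (Q.side i), M :=
              setLIntegral_mono' (hΩ.measurableSet.diff hU) fun x hx ↦ hf x hx.1
          _ ≤ _ := by
              rw [setLIntegral_const]
              gcongr
              exact Q.volume_diff_le hδ

theorem exists_forall_enorm_fderiv_le (hv : ContDiff ℝ 1 v) (hK : IsCompact (closure Ω)) :
    ∃ K : ℝ≥0, ∀ x ∈ Ω, ‖fderiv ℝ v x‖ₑ ^ p.toReal ≤ K := by
  obtain ⟨K, hK⟩ := hK.exists_bound_of_continuousOn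
    (hv.continuous_fderiv one_ne_zero).continuousOn
  refine ⟨K.toNNReal ^ p.toReal, fun x hx ↦ ?_⟩
  rw [ENNReal.coe_rpow_of_nonneg _ ENNReal.toReal_nonneg]
  gcongr
  rw [← ofReal_norm]
  exact ENNReal.ofReal_le_ofReal (hK x (subset_closure hx))

theorem lintegral_psi_fderiv_ne_top (hp : 1 ≤ p) (hp' : p ≠ ∞)
    (hα : IsCoreFunctional p D (similarities 𝒢) α) {c : ℝ≥0} (hc : IsGradientBound p D 𝒢 α c)
    (hv : ContDiff ℝ 1 v) (hΩ : IsOpen Ω) (hK : IsCompact (closure Ω)) :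
    ∫⁻ x in Ω, psi p D 𝒢 α (fderiv ℝ v x) ≠ ∞ := by
  have hfin : volume Ω ≠ ∞ := ne_top_of_le_ne_top hK.measure_lt_top.ne (measure_mono subset_closure)
  obtain ⟨K, hKb⟩ := exists_forall_enorm_fderiv_le (p := p) hv hK
  refine ne_top_of_le_ne_top (b := c * K * volume Ω) (by finiteness) ?_
  rw [← setLIntegral_const]
  exact setLIntegral_mono' hΩ.measurableSet fun x hx ↦
    (hc.psi_le hp hp' hα _).trans (by gcongr; exact hKb x hx)

theorem tendsto_G_of_contDiff (hp : 1 ≤ p) (hp' : p ≠ ∞) (hDb : Bornology.IsBounded D)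
    (hα : IsCoreFunctional p D (similarities 𝒢) α) {c : ℝ≥0} (hc : IsGradientBound p D 𝒢 α c)
    (hv : ContDiff ℝ 1 v) (hΩ : IsOpen Ω) (hK : IsCompact (closure Ω)) :
    Tendsto (fun ε ↦ G p D 𝒢 α ε v Ω) (𝓝[>] (0 : ℝ))
      (𝓝 (∫⁻ x in Ω, psi p D 𝒢 α (fderiv ℝ v x))) := by
  have hfin : volume Ω ≠ ∞ := ne_top_of_le_ne_top hK.measure_lt_top.ne (measure_mono subset_closure)
  obtain ⟨V, hV⟩ : ∃ V : ℝ≥0, (V : ℝ≥0∞) = volume Ω := ⟨_, ENNReal.coe_toNNReal hfin⟩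
  obtain ⟨K, hKb⟩ := exists_forall_enorm_fderiv_le (p := p) hv hK
  -- The quasi-triangle inequality is used twice, between `v` and its linear part and between
  -- `ψ(∇v)` and its value at the centre, whence `a = √a'`. In the bracket, `(a + 1) b c V` collects
  -- the errors of these two comparisons, `c K` the uncovered set, and `a` the slack `e` in the
  -- limit over the cubes.
  have hprep : ∀ a' : ℝ≥0, 1 < a' → ∀ θ : ℝ≥0, 0 < θ → ∃ a b e : ℝ≥0,
      IsQuasiTriangle p D 𝒢 α a b ∧ a * a = a' ∧ 0 < e ∧
        ((a + 1) * (b * (c * V)) + a + c * K) * e ≤ θ := by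
    intro a' ha' θ hθ
    have ha : 1 < NNReal.sqrt a' := by
      rw [← NNReal.sqrt_one]; exact NNReal.sqrt_lt_sqrt.2 ha'
    obtain ⟨b, hb⟩ := exists_G_add_le hα ha
    set a := NNReal.sqrt a'
    have hM : 0 < (a + 1) * (b * (c * V)) + a + c * K := by
      have : 0 < a := one_pos.trans ha
      positivity
    refine ⟨a, b, θ / ((a + 1) * (b * (c * V)) + a + c * K), hb, NNReal.mul_self_sqrt a',
      div_pos hθ hM, (mul_div_cancel₀ θ hM.ne').le⟩
  refine tendsto_of_eventually_le_mul_add (lintegral_psi_fderiv_ne_top hp hp' hα hc hv hΩ hK)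
    (fun a' ha' θ hθ ↦ ?_) (fun a' ha' θ hθ ↦ ?_)
  · obtain ⟨a, b, e, hab, rfl, he, hθe⟩ := hprep a' ha' θ hθ
    obtain ⟨ι, _, ρ, δ, Q, hδ, hQ⟩ := exists_cubeFilling_gradient hp hp' hv hΩ hK he
    filter_upwards [eventually_G_le_sum_cubes hDb hc Q hδ hv, self_mem_nhdsWithin] with ε h hε
    have hε : 0 < ε := hε
    have hU : MeasurableSet (⋃ i, cube (Q.center i) (δ * Q.side i)) :=
      .iUnion fun i ↦ (isOpen_cube _ _).measurableSet
    have hbd : ∫⁻ x in Ω \ ⋃ i, cube (Q.center i) (δ * Q.side i), ‖fderiv ℝ v x‖ₑ ^ p.toReal ≤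
        K * e := by
      calc _ ≤ ∫⁻ _ in Ω \ ⋃ i, cube (Q.center i) (δ * Q.side i), (K : ℝ≥0∞) :=
            setLIntegral_mono' (hΩ.measurableSet.diff hU) fun x hx ↦ hKb x hx.1
        _ ≤ _ := by
            rw [setLIntegral_const]
            gcongr
            exact Q.volume_le
    have hloc : ∀ i, G p D 𝒢 α ε v (cube (Q.center i) (Q.side i)) ≤
        a * a * (∫⁻ x in cube (Q.center i) (Q.side i), psi p D 𝒢 α (fderiv ℝ v x)) +
          (a + 1) * (b * (c * e)) * volume (cube (Q.center i) (Q.side i)) := fun i ↦ by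
      calc _ ≤ a * G p D 𝒢 α ε (fun x ↦ fderiv ℝ v (Q.center i) x)
              (cube (Q.center i) (Q.side i)) +
            b * (c * (e * volume (cube (Q.center i) (Q.side i)))) :=
            hab.G_le_linear hc hε hv _ (Q.measurableSet i) (hQ i)
        _ ≤ a * (a * (∫⁻ x in cube (Q.center i) (Q.side i), psi p D 𝒢 α (fderiv ℝ v x)) +
              b * (c * (e * volume (cube (Q.center i) (Q.side i))))) +
            b * (c * (e * volume (cube (Q.center i) (Q.side i)))) := by
            gcongr
            exact (G_linear_cube_le hp hp' hα hε _ (Q.side_pos i) _).trans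
              (hab.volume_mul_psi_le hp hp' hα hc _ (Q.measurableSet i) (hQ i))
        _ = _ := by ring
    calc _ ≤ ∑ i, (a * a * (∫⁻ x in cube (Q.center i) (Q.side i), psi p D 𝒢 α (fderiv ℝ v x)) +
          (a + 1) * (b * (c * e)) * volume (cube (Q.center i) (Q.side i))) + c * (K * e) := by
          refine h.trans ?_
          gcongr with i
          exact hloc i
      _ ≤ a * a * (∫⁻ x in Ω, psi p D 𝒢 α (fderiv ℝ v x)) +
          (a + 1) * (b * (c * e)) * V + c * (K * e) := by
          rw [Finset.sum_add_distrib, ← Finset.mul_sum, ← Finset.mul_sum, hV]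
          gcongr
          · exact Q.sum_lintegral_le _
          · exact Q.sum_volume_le
      _ ≤ a * a * (∫⁻ x in Ω, psi p D 𝒢 α (fderiv ℝ v x)) +
          (((a + 1) * (b * (c * V)) + a + c * K) * e : ℝ≥0) := by
          push_cast
          rw [add_assoc]
          gcongr
          calc _ = ((a + 1) * (b * (c * V)) + c * K) * (e : ℝ≥0∞) := by ring
            _ ≤ _ := by gcongr; exact le_self_add
      _ ≤ _ := by
          rw [← ENNReal.coe_mul]
          gcongr
  · obtain ⟨a, b, e, hab, rfl, he, hθe⟩ := hprep a' ha' θ hθ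
    obtain ⟨ι, _, ρ, δ, Q, hδ, hQ⟩ := exists_cubeFilling_gradient hp hp' hv hΩ hK he
    -- The cubes are fixed before `ε → 0`, so the limit passes through the finite sum; the added `e`
    -- turns convergence into an eventual inequality.
    have hlim := (tendsto_finsetSum Finset.univ fun i _ ↦ tendsto_G_linear_cube hp hp' hα
      (fderiv ℝ v (Q.center i)) (Q.side_pos i) (Q.center i)).add_const (e : ℝ≥0∞)
    set S := ∑ i, volume (cube (Q.center i) (Q.side i)) * psi p D 𝒢 α (fderiv ℝ v (Q.center i))
      with hS
    have hSfin : S ≠ ∞ := by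
      refine ENNReal.sum_ne_top.2 fun i _ ↦ ENNReal.mul_ne_top ?_ ?_
      · simp [volume_cube (Q.side_pos i)]
      · exact ne_top_of_le_ne_top (by finiteness) (hc.psi_le hp hp' hα _)
    have hlt : S < S + e := ENNReal.lt_add_right hSfin (by simpa using he.ne')
    filter_upwards [(tendsto_order.1 hlim).1 S hlt, self_mem_nhdsWithin] with ε h hε
    have hε : 0 < ε := hε
    have h1 : ∑ i, G p D 𝒢 α ε (fun x ↦ fderiv ℝ v (Q.center i) x)
        (cube (Q.center i) (Q.side i)) ≤ a * G p D 𝒢 α ε v Ω + b * (c * (e * V)) := by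
      calc _ ≤ ∑ i, (a * G p D 𝒢 α ε v (cube (Q.center i) (Q.side i)) +
            b * (c * (e * volume (cube (Q.center i) (Q.side i))))) :=
            Finset.sum_le_sum fun i _ ↦
              hab.G_linear_le hc hε hv _ (Q.measurableSet i) (hQ i)
        _ ≤ _ := by
            rw [Finset.sum_add_distrib, ← Finset.mul_sum, ← Finset.mul_sum, ← Finset.mul_sum,
              ← Finset.mul_sum, hV]
            gcongr
            · exact sum_G_le_of_disjoint hp hp' hα hε (.of_continuous hv.continuous) _ _
                (fun i _ ↦ Q.subset i) (fun i _ j _ hij ↦ Q.disjoint hij)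
            · exact Q.sum_volume_le
    have h2 : ∑ i, (∫⁻ x in cube (Q.center i) (Q.side i), psi p D 𝒢 α (fderiv ℝ v x)) ≤
        a * S + b * (c * (e * V)) := by
      calc _ ≤ ∑ i, (a * (volume (cube (Q.center i) (Q.side i)) *
            psi p D 𝒢 α (fderiv ℝ v (Q.center i))) +
            b * (c * (e * volume (cube (Q.center i) (Q.side i))))) :=
            Finset.sum_le_sum fun i _ ↦
              hab.lintegral_psi_le hp hp' hα hc _ (Q.measurableSet i) (hQ i)
        _ ≤ _ := by
            rw [Finset.sum_add_distrib, ← Finset.mul_sum, ← Finset.mul_sum, ← Finset.mul_sum,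
              ← Finset.mul_sum, hV]
            gcongr
            exact Q.sum_volume_le
    have h3 := Q.lintegral_le hδ hΩ (f := fun x ↦ psi p D 𝒢 α (fderiv ℝ v x)) (M := c * K)
      fun x hx ↦ (hc.psi_le hp hp' hα _).trans (by gcongr; exact hKb x hx)
    calc _ ≤ a * S + b * (c * (e * V)) + c * K * e := h3.trans (by gcongr)
      _ ≤ a * (a * G p D 𝒢 α ε v Ω + b * (c * (e * V)) + e) + b * (c * (e * V)) + c * K * e := by
          gcongr
          exact h.le.trans (by gcongr)
      _ = a * a * G p D 𝒢 α ε v Ω + (((a + 1) * (b * (c * V)) + a + c * K) * e : ℝ≥0) := by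
          push_cast
          ring
      _ ≤ _ := by
          rw [← ENNReal.coe_mul]
          gcongr

/-! ### Convolutions as averages of translates in `L^p` -/

/-- Pairing with the indicator of `A` in the conjugate space. These functionals commute with Bochner
integrals and separate elements of `L^p`. -/
theorem exists_clm_setIntegral [hp : Fact (1 ≤ p)] {A : Set (E n)} (hA : MeasurableSet A)
    (hfin : volume A ≠ ∞) :
    ∃ T : Lp (E m) p (volume : Measure (E n)) →L[ℝ] E m, ∀ f, T f = ∫ x in A, f x := by
  have : p.HolderConjugate p.conjExponent := .conjExponent hp.out
  have : p.conjExponent.HolderConjugate p := inferInstance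
  have : Fact (1 ≤ p.conjExponent) := ⟨ENNReal.HolderConjugate.one_le _ p⟩
  refine ⟨(ContinuousLinearMap.lsmul ℝ ℝ).lpPairing volume p.conjExponent p
    (indicatorConstLp _ hA hfin (1 : ℝ)), fun f ↦ ?_⟩
  rw [ContinuousLinearMap.lpPairing_eq_integral, ← integral_indicator hA]
  refine integral_congr_ae ?_
  filter_upwards [indicatorConstLp_coeFn (μ := volume) (p := p.conjExponent) (hs := hA)
    (hμs := hfin) (c := (1 : ℝ))] with x hx
  rw [hx]
  by_cases h : x ∈ A <;> simp [h]

theorem mk_vadd_toLp_ae_eq {U : E n → E m}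
    (hU : MemLp U p (volume : Measure (E n))) (y : E n) :
    (DomAddAct.mk (-y) +ᵥ hU.toLp U : Lp (E m) p (volume : Measure (E n))) =ᵐ[volume]
      fun x ↦ U (x - y) := by
  rw [DomAddAct.mk_vadd_toLp]
  refine (MemLp.coeFn_toLp _).trans (ae_of_all _ fun x ↦ ?_)
  simp [neg_add_eq_sub]

/-- `κ dy` is a probability measure and, as `p < ∞`, translation is continuous into `L^p`. The
Bochner mean of the translates therefore lies in the closed convex set `S`. Integrating over sets of
finite measure and applying Fubini identifies this mean with the convolution. -/
theorem exists_mem_ae_eq_convolution [Fact (1 ≤ p)] (hp' : p ≠ ∞) {κ : E n → ℝ}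
    (hκ : Continuous κ) (hκ0 : ∀ x, 0 ≤ κ x) (hκi : Integrable κ) (hκ1 : ∫ x, κ x = 1)
    {U : E n → E m} (hU : MemLp U p (volume : Measure (E n))) (hUi : Integrable U)
    {S : Set (Lp (E m) p (volume : Measure (E n)))} (hS : Convex ℝ S) (hSc : IsClosed S)
    (hmem : ∀ y, κ y ≠ 0 → DomAddAct.mk (-y) +ᵥ hU.toLp U ∈ S) :
    ∃ J ∈ S, J =ᵐ[volume] convolution κ U (ContinuousLinearMap.lsmul ℝ ℝ) volume := by
  have : Fact (p ≠ ∞) := ⟨hp'⟩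
  set F : E n → Lp (E m) p (volume : Measure (E n)) := fun y ↦ DomAddAct.mk (-y) +ᵥ hU.toLp U
  have hFc : Continuous F :=
    (DomAddAct.continuous_mk.comp continuous_neg).vadd continuous_const
  have hκm : Measurable fun x ↦ ENNReal.ofReal (κ x) := hκ.measurable.ennreal_ofReal
  set μ : Measure (E n) := volume.withDensity fun x ↦ ENNReal.ofReal (κ x) with hμ
  have : IsProbabilityMeasure μ := ⟨by
    rw [hμ, withDensity_apply _ .univ, Measure.restrict_univ,
      ← ofReal_integral_eq_lintegral_ofReal hκi (ae_of_all _ hκ0), hκ1, ENNReal.ofReal_one]⟩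
  have hint : ∀ (f : E n → E m), ∫ y, f y ∂μ = ∫ y, κ y • f y := fun f ↦ by
    rw [hμ, integral_withDensity_eq_integral_toReal_smul hκm (ae_of_all _ fun _ ↦ by simp)]
    simp only [ENNReal.toReal_ofReal (hκ0 _)]
  have hFi : Integrable F μ := by
    refine Integrable.of_bound hFc.aestronglyMeasurable ‖hU.toLp U‖ (ae_of_all _ fun y ↦ ?_)
    rw [DomAddAct.norm_vadd_Lp]
  refine ⟨∫ y, F y ∂μ, hS.integral_mem hSc ?_ hFi, ?_⟩
  · rw [ae_withDensity_iff hκm]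
    refine ae_of_all _ fun y hy ↦ hmem y fun h ↦ hy ?_
    rw [h, ENNReal.ofReal_zero]
  have hconv := hκi.integrable_convolution (ContinuousLinearMap.lsmul ℝ ℝ) hUi
  refine ae_eq_of_forall_setIntegral_eq_of_sigmaFinite
    (fun A _ hfin ↦ integrableOn_Lp_of_measure_ne_top _ Fact.out hfin.ne)
    (fun A _ _ ↦ hconv.integrableOn) fun A hA hfin ↦ ?_
  obtain ⟨T, hT⟩ := exists_clm_setIntegral (m := m) (p := p) hA hfin.ne
  have hTF : ∀ y, T (F y) = ∫ x in A, U (x - y) := fun y ↦ by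
    rw [hT]
    exact integral_congr_ae (ae_restrict_of_ae (mk_vadd_toLp_ae_eq hU y))
  rw [← hT, ← T.integral_comp_comm hFi, hint]
  simp only [hTF, ← integral_smul, convolution, ContinuousLinearMap.lsmul_apply]
  refine (integral_integral_swap ?_).symm
  have h1 := hκi.convolution_integrand (ContinuousLinearMap.lsmul ℝ ℝ) hUi (μ := volume)
  refine h1.mono_measure ?_
  conv_lhs => rw [← Measure.restrict_univ (μ := (volume : Measure (E n))),
    Measure.restrict_restrict hA, inter_univ, Measure.prod_restrict]
  exact Measure.restrict_le_self

/-! ### Sublevel sets of sums of core functionals -/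

theorem MemLpLoc.of_Lp (f : Lp (E m) p (volume : Measure (E n))) : MemLpLoc p f :=
  fun _ _ ↦ (Lp.memLp f).restrict _

theorem isClosed_sublevel [Fact (1 ≤ p)] {s : Finset (Set (E n))}
    (hlsc : ∀ D' ∈ s, LowerSemicontinuous
      (fun f : Lp (E m) p (volume : Measure (E n)) ↦ α f D')) (M : ℝ≥0) :
    IsClosed {f : Lp (E m) p (volume : Measure (E n)) | ∑ D' ∈ s, α f D' ≤ M} :=
  (lowerSemicontinuous_sum hlsc).isClosed_preimage M

theorem convex_sublevel [Fact (1 ≤ p)] (hα : IsCoreFunctional p D (similarities 𝒢) α)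
    {s : Finset (Set (E n))} (hs : ∀ D' ∈ s, D' ∈ images (similarities 𝒢 : Set _) D univ)
    (M : ℝ≥0) :
    Convex ℝ {f : Lp (E m) p (volume : Measure (E n)) | ∑ D' ∈ s, α f D' ≤ M} := by
  intro f hf g hg a b ha hb hab
  lift a to ℝ≥0 using ha
  lift b to ℝ≥0 using hb
  have hab : a + b = 1 := by exact_mod_cast hab
  have hle : ∀ D' ∈ s, α ((a : ℝ) • f + (b : ℝ) • g : Lp (E m) p (volume : Measure (E n))) D' ≤
      a * α f D' + b * α g D' := fun D' hD' ↦ by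
    refine le_of_eq_of_le ?_ (hα.convex D' (hs D' hD') f g (.of_Lp f) (.of_Lp g) a b hab)
    refine hα.extension_independent D' (hs D' hD') _ _ (.of_Lp _)
      (((MemLpLoc.of_Lp f).const_smul _).add ((MemLpLoc.of_Lp g).const_smul _))
      (ae_restrict_of_ae ?_)
    filter_upwards [Lp.coeFn_add ((a : ℝ) • f) ((b : ℝ) • g), Lp.coeFn_smul (a : ℝ) f,
      Lp.coeFn_smul (b : ℝ) g] with x h1 h2 h3
    rw [h1, Pi.add_apply, h2, h3, Pi.add_apply]
  calc ∑ D' ∈ s, _ ≤ ∑ D' ∈ s, (a * α f D' + b * α g D') := Finset.sum_le_sum hle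
    _ = a * ∑ D' ∈ s, α f D' + b * ∑ D' ∈ s, α g D' := by
        rw [Finset.sum_add_distrib, ← Finset.mul_sum, ← Finset.mul_sum]
    _ ≤ a * M + b * M := by
        gcongr
        exacts [hf, hg]
    _ = M := by rw [← add_mul, hab, one_mul]

/-! ### Mollification -/

section Mollifier

variable {ρ : E n → ℝ} {σ : ℝ}

theorem rescale_eq_zero (hρ : IsStandardMollifier ρ) (hσ : 0 < σ) {x : E n}
    (hx : rescale ρ σ x ≠ 0) : ‖x‖ ≤ σ := by
  have h1 : ρ (σ⁻¹ • x) ≠ 0 := fun h ↦ hx (by simp [rescale, h])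
  have h2 := hρ.tsupport_subset (subset_tsupport _ h1)
  rw [mem_closedBall_zero_iff, norm_smul, norm_inv, Real.norm_of_nonneg hσ.le] at h2
  rwa [inv_mul_le_iff₀ hσ, mul_one] at h2

theorem contDiff_rescale (hρ : IsStandardMollifier ρ) :
    ContDiff ℝ ((⊤ : ℕ∞) : WithTop ℕ∞) (rescale ρ σ) :=
  contDiff_const.mul (hρ.contDiff.comp (contDiff_const_smul _))

theorem hasCompactSupport_rescale (hρ : IsStandardMollifier ρ) (hσ : 0 < σ) :
    HasCompactSupport (rescale ρ σ) :=
  HasCompactSupport.of_support_subset_isCompact (isCompact_closedBall 0 σ) fun _ hx ↦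
    mem_closedBall_zero_iff.2 (rescale_eq_zero hρ hσ hx)

theorem integral_rescale (hρ : IsStandardMollifier ρ) (hσ : 0 < σ) :
    ∫ x, rescale ρ σ x = 1 := by
  simp only [rescale]
  rw [integral_const_mul, Measure.integral_comp_inv_smul, hρ.integral_eq_one,
    finrank_euclideanSpace_fin, abs_of_pos (by positivity), smul_eq_mul, mul_one,
    inv_mul_cancel₀ (by positivity)]

theorem contDiff_mollify (hρ : IsStandardMollifier ρ) (hσ : 0 < σ) (hp : 1 ≤ p)
    (hu : MemLpLoc p u) : ContDiff ℝ 1 (mollify ρ σ u) :=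
  ((hasCompactSupport_rescale hρ hσ).contDiff_convolution_left _ (contDiff_rescale hρ)
    (hu.locallyIntegrable hp)).of_le (by exact_mod_cast le_top)

theorem mollify_congr (hρ : IsStandardMollifier ρ) (hσ : 0 < σ) {x : E n}
    (h : ∀ y, ‖y‖ ≤ σ → u (x - y) = v (x - y)) : mollify ρ σ u x = mollify ρ σ v x := by
  simp only [mollify, convolution, ContinuousLinearMap.lsmul_apply]
  congr 1 with y : 1
  by_cases hy : rescale ρ σ y = 0
  · simp [hy]
  · rw [h y (rescale_eq_zero hρ hσ hy)]

/-- The segment from `x` to `x - y` is too short to reach the boundary of `Ω`, and a connected set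
starting in `Ω` cannot leave it otherwise. -/
theorem sub_mem_of_lt_setDist (hΩ : IsOpen Ω) (hsub : Ω' ⊆ Ω)
    (hdist : ENNReal.ofReal σ < setDist Ω' (frontier Ω)) {x y : E n} (hx : x ∈ Ω')
    (hy : ‖y‖ ≤ σ) : x - y ∈ Ω := by
  have hdisj : segment ℝ x (x - y) ⊆ Ω ∪ (closure Ω)ᶜ := by
    intro z hz
    by_contra hcon
    simp only [mem_union, mem_compl_iff, not_or, not_not] at hcon
    have hzf : z ∈ frontier Ω := by rw [hΩ.frontier_eq]; exact ⟨hcon.2, hcon.1⟩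
    have h1 : edist x z ≤ ENNReal.ofReal σ := by
      rw [edist_dist]
      refine ENNReal.ofReal_le_ofReal ?_
      have h1 := dist_add_dist_of_mem_segment hz
      rw [dist_self_sub_right] at h1
      linarith [dist_nonneg (x := z) (y := x - y)]
    have h2 : setDist Ω' (frontier Ω) ≤ edist x z := iInf₂_le_of_le x hx (iInf₂_le z hzf)
    exact (h2.trans h1).not_gt hdist
  exact (convex_segment x (x - y)).isPreconnected.subset_left_of_subset_union hΩ
    isClosed_closure.isOpen_compl (disjoint_compl_right.mono_left subset_closure) hdisj
    ⟨x, left_mem_segment ℝ _ _, hsub hx⟩ (right_mem_segment ℝ _ _)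

theorem sum_alpha_translate_le (hα : IsCoreFunctional p D (similarities 𝒢) α) (hε : 0 < ε)
    (hu : MemLpLoc p u) (y : E n) (hy : ∀ x ∈ Ω', x - y ∈ Ω) {s : Finset (Set (E n))}
    (hs : IsPacking D 𝒢 ε Ω' s) :
    ENNReal.ofReal (ε ^ ((n : ℝ) - p.toReal)) *
      ∑ D' ∈ s, (α (u ∘ homothety 1 one_pos.ne' (-y)) D' : ℝ≥0∞) ≤ G p D 𝒢 α ε u Ω := by
  refine hs.sum_le_G.trans ?_
  have h := G_comp_homothety_le (Ω := Ω') hα hε hu one_pos (-y)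
  rw [Real.one_rpow, ENNReal.ofReal_one, one_mul, one_mul] at h
  refine h.trans (G_mono ?_)
  rintro _ ⟨x, hx, rfl⟩
  simpa [sub_eq_add_neg] using hy x hx

/-- Fix a finite packing of `Ω'`. Shifted by at most `σ` it is still a packing of `Ω`, so all
relevant translates of `u` lie in one convex closed sublevel set, and so does their mean `ρ_σ * u`.
-/
theorem G_mollify_le [hp : Fact (1 ≤ p)] (hp' : p ≠ ∞)
    (hα : IsCoreFunctional p D (similarities 𝒢) α)
    (hlsc : ∀ D' ∈ images (similarities 𝒢 : Set _) D univ, LowerSemicontinuous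
      (fun f : Lp (E m) p (volume : Measure (E n)) ↦ α f D'))
    (hρ : IsStandardMollifier ρ) (hσ : 0 < σ) (hΩ : IsOpen Ω) (hΩ' : IsOpen Ω')
    (hb : Bornology.IsBounded Ω') (hsub : Ω' ⊆ Ω)
    (hdist : ENNReal.ofReal σ < setDist Ω' (frontier Ω)) (hu : MemLpLoc p u) (hε : 0 < ε) :
    G p D 𝒢 α ε (mollify ρ σ u) Ω' ≤ G p D 𝒢 α ε u Ω := by
  refine G_le fun s hs ↦ ?_
  by_cases htop : G p D 𝒢 α ε u Ω = ∞
  · simp [htop]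
  set k := ENNReal.ofReal (ε ^ ((n : ℝ) - p.toReal)) with hk
  have hk0 : k ≠ 0 := by simpa [hk] using Real.rpow_pos_of_pos hε _
  have hkt : k ≠ ∞ := ENNReal.ofReal_ne_top
  have hsim : ∀ D' ∈ s, D' ∈ images (similarities 𝒢 : Set _) D univ := fun D' hD' ↦
    images_subset_images_similarities hε (hs.1 D' hD')
  obtain ⟨M, hM⟩ : ∃ M : ℝ≥0, (M : ℝ≥0∞) = G p D 𝒢 α ε u Ω / k :=
    ⟨_, ENNReal.coe_toNNReal (ENNReal.div_ne_top htop hk0)⟩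
  obtain ⟨r, hr⟩ := hb.subset_closedBall 0
  -- `u` is only locally in `L^p`. Cutting it off outside `B`, which contains the `σ`-neighbourhood
  -- of `Ω'`, puts it in `L^p` without changing its relevant translates or its mollification on
  -- `Ω'`.
  set B : Set (E n) := Metric.closedBall 0 (r + σ)
  have hB : ∀ x ∈ Ω', ∀ y : E n, ‖y‖ ≤ σ → x - y ∈ B := fun x hx y hy ↦ by
    have h1 := mem_closedBall_zero_iff.1 (hr hx)
    exact mem_closedBall_zero_iff.2 ((norm_sub_le x y).trans (add_le_add h1 hy))
  have hBc : IsCompact B := isCompact_closedBall 0 _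
  set U : E n → E m := B.indicator u
  have hU : MemLp U p := (memLp_indicator_iff_restrict hBc.measurableSet).2 (hu B hBc)
  have hUi : Integrable U := (integrable_indicator_iff hBc.measurableSet).2
    (hu.locallyIntegrable hp.out |>.integrableOn_isCompact hBc)
  have hUu : ∀ x ∈ Ω', ∀ y : E n, ‖y‖ ≤ σ → U (x - y) = u (x - y) := fun x hx y hy ↦
    indicator_of_mem (hB x hx y hy) u
  have hmem : ∀ D' ∈ s, ∀ᵐ x ∂(volume.restrict D'), x ∈ Ω' := fun D' hD' ↦
    ae_restrict_of_ae_restrict_of_subset (hs.1 D' hD').1 (ae_restrict_mem hΩ'.measurableSet)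
  have hκ := contDiff_rescale (σ := σ) hρ
  obtain ⟨J, hJ, hJe⟩ := exists_mem_ae_eq_convolution hp' hκ.continuous
    (fun x ↦ mul_nonneg (by positivity) (hρ.nonneg _))
    (hκ.continuous.integrable_of_hasCompactSupport (hasCompactSupport_rescale hρ hσ))
    (integral_rescale hρ hσ) hU hUi (convex_sublevel hα hsim M)
    (isClosed_sublevel (fun D' hD' ↦ hlsc D' (hsim D' hD')) M) (fun y hy ↦ by
      have hy := rescale_eq_zero hρ hσ hy
      have h1 := sum_alpha_translate_le hα hε hu y
        (fun x hx ↦ sub_mem_of_lt_setDist hΩ hsub hdist hx hy) hs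
      rw [mul_comm, ← ENNReal.le_div_iff_mul_le (.inl hk0) (.inl hkt), ← hM] at h1
      have h2 : ∀ D' ∈ s, α (DomAddAct.mk (-y) +ᵥ hU.toLp U :
          Lp (E m) p (volume : Measure (E n))) D' =
          α (u ∘ homothety 1 one_pos.ne' (-y)) D' := fun D' hD' ↦ by
        refine hα.extension_independent D' (hsim D' hD') _ _ (.of_Lp _)
          (hu.comp_homothety one_pos _) ?_
        filter_upwards [ae_restrict_of_ae (mk_vadd_toLp_ae_eq hU y), hmem D' hD'] with x h3 hx
        rw [h3, hUu x hx y hy]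
        simp [sub_eq_add_neg]
      show ∑ D' ∈ s, _ ≤ M
      rw [Finset.sum_congr rfl h2]
      exact_mod_cast h1)
  have h3 : ∀ D' ∈ s, α (mollify ρ σ u) D' = α J D' := fun D' hD' ↦ by
    refine hα.extension_independent D' (hsim D' hD') _ _
      (.of_continuous (contDiff_mollify hρ hσ hp.out hu).continuous) (.of_Lp _) ?_
    filter_upwards [ae_restrict_of_ae hJe, hmem D' hD'] with x hx hxΩ
    rw [hx]
    exact mollify_congr hρ hσ fun y hy ↦ (hUu x hxΩ y hy).symm
  rw [mul_comm, ← ENNReal.le_div_iff_mul_le (.inl hk0) (.inl hkt), ← hM,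
    Finset.sum_congr rfl fun D' hD' ↦ by rw [h3 D' hD']]
  exact_mod_cast hJ

end Mollifier

end BMOType

end

/-! ### Assembly of the theorem -/

theorem mainTheorem8 {n m : ℕ} (hn : 1 ≤ n) (hm : 1 ≤ m)
    (p : ℝ≥0∞) [Fact (1 ≤ p)] (hp : p ≠ ∞)
    (𝒢 : Subgroup (BMOType.SO n)) (D : Set (BMOType.E n)) (hD : IsOpen D)
    (hDb : Bornology.IsBounded D)
    (α : (BMOType.E n → BMOType.E m) → Set (BMOType.E n) → ℝ≥0)
    (hα : BMOType.IsCoreFunctional p D (BMOType.similarities 𝒢) α)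
    (hlsc : ∀ D' ∈ BMOType.images (BMOType.similarities 𝒢 : Set _) D univ,
      LowerSemicontinuous
        (fun f : Lp (BMOType.E m) p (volume : Measure (BMOType.E n)) ↦ α f D')) :
    -- the integrand `ψ` is well defined and finite
    (∀ A : BMOType.E n →L[ℝ] BMOType.E m,
      Tendsto (fun ε ↦ BMOType.G p D 𝒢 α ε (fun x ↦ A x) (BMOType.Q n)) (𝓝[>] (0 : ℝ))
        (𝓝 (BMOType.psi p D 𝒢 α A)) ∧ BMOType.psi p D 𝒢 α A ≠ ∞) ∧
    -- its null set is a linear subspace `𝒩`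
    ∃ 𝒩 : Submodule ℝ (BMOType.E n →L[ℝ] BMOType.E m),
      (𝒩 : Set (BMOType.E n →L[ℝ] BMOType.E m)) = {A | BMOType.psi p D 𝒢 α A = 0} ∧
      ∀ (P : Submodule ℝ (BMOType.E n →L[ℝ] BMOType.E m)) (hP : IsCompl P 𝒩),
        ∃ C : ℝ≥0, 0 < C ∧
          ∀ (ρ : BMOType.E n → ℝ), BMOType.IsStandardMollifier ρ →
          ∀ (Ω Ω' : Set (BMOType.E n)), IsOpen Ω → IsOpen Ω' →
            IsCompact (closure Ω') → closure Ω' ⊆ Ω →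
          ∀ (u : BMOType.E n → BMOType.E m), BMOType.MemLpLoc p u →
          ∀ σ : ℝ, 0 < σ → ENNReal.ofReal σ < BMOType.setDist Ω' (frontier Ω) →
            C * ∫⁻ x in Ω', ‖P.projection 𝒩 hP
                (fderiv ℝ (BMOType.mollify ρ σ u) x)‖ₑ ^ p.toReal ≤
              ∫⁻ x in Ω', BMOType.psi p D 𝒢 α (fderiv ℝ (BMOType.mollify ρ σ u) x) ∧
            Tendsto (fun ε ↦ BMOType.G p D 𝒢 α ε (BMOType.mollify ρ σ u) Ω') (𝓝[>] (0 : ℝ))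
              (𝓝 (BMOType.Glim p D 𝒢 α (BMOType.mollify ρ σ u) Ω')) ∧
            ∫⁻ x in Ω', BMOType.psi p D 𝒢 α (fderiv ℝ (BMOType.mollify ρ σ u) x) =
              BMOType.Glim p D 𝒢 α (BMOType.mollify ρ σ u) Ω' ∧
            BMOType.Glim p D 𝒢 α (BMOType.mollify ρ σ u) Ω' ≤ BMOType.Gminus p D 𝒢 α u Ω := by

  have hp1 : 1 ≤ p := Fact.out
  obtain ⟨c, hc⟩ := BMOType.exists_isGradientBound hD hDb hα
  refine ⟨fun A ↦ ⟨BMOType.tendsto_psi hp1 hp hα A, ne_top_of_le_ne_top (by finiteness)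
    (hc.psi_le hp1 hp hα A)⟩, BMOType.nullSubmodule hp1 hp hα, rfl, fun P hP ↦ ?_⟩
  obtain ⟨C, hC0, hC⟩ := BMOType.exists_mul_enorm_projection_le hp1 hp hα hc P hP
  refine ⟨C, hC0, fun ρ hρ Ω Ω' hΩ hΩ' hK hsub u hu σ hσ hdist ↦ ?_⟩
  have hlim := BMOType.tendsto_G_of_contDiff hp1 hp hDb hα hc
    (BMOType.contDiff_mollify hρ hσ hp1 hu) hΩ' hK
  have hG : BMOType.Glim p D 𝒢 α (BMOType.mollify ρ σ u) Ω' = _ := hlim.limUnder_eq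
  refine ⟨?_, hG ▸ hlim, hG.symm, ?_⟩
  · rw [← lintegral_const_mul' _ _ ENNReal.coe_ne_top]
    exact lintegral_mono fun x ↦ hC _
  · rw [hG, BMOType.Gminus, ← hlim.liminf_eq]
    refine liminf_le_liminf ?_
    filter_upwards [self_mem_nhdsWithin] with ε hε
    exact BMOType.G_mollify_le hp hα hlsc hρ hσ hΩ hΩ' (hK.isBounded.subset subset_closure)
      (subset_closure.trans hsub) hdist hu hε
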